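/- **Setting.** A QBF is a closed prenex formula $\mathcal Q.\,\phi$ with $\phi$ in CNF, no clause of $\phi$ being tautological and no variable being quantified twice; $\mathrm{ind}(x)$ is the position of the variable $x$ in the prefix. Consider QBFs of the form $$\mathcal F=\exists \vec p\,\mathcal Q\vec q\,\mathcal Q\vec r\,[A(\vec p,\vec q)\wedge B(\vec p,\vec r)],$$ where $\vec p,\vec q,\vec r$ are mutually disjoint, the CNF $A$ uses only variables from $\vec p,\vec q$, the CNF $B$ uses only variables from $\vec p,\vec r$, and the quantification of $\vec q$ and $\vec r$ is arbitrary. An *interpolation circuit* for $\mathcal F$ is a Boolean circuit $G$ with inputs among $\vec p$ such that for every assignment $\vec a$ to $\vec p$: if $G(\vec a)=0$ then $\mathcal Q\vec q.A(\vec a,\vec q)$ is false, and if $G(\vec a)=1$ then $\mathcal Q\vec r.B(\vec a,\vec r)$ is false. A *proof* of $\mathcal F$ in a calculus is a sequence of clauses (read as sets of literals) ending in the empty clause, each line carrying the rule application by which it is obtained: it is a leaf, together with the clause of the matrix it comes from, or it follows from earlier lines by a rule of the calculus. Its size is its number of clauses. A circuit is *monotone* if it contains no negation and no selector gate. A calculus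 $S$ has *monotone feasible interpolation* if there is a computable procedure that, given $\mathcal F$ and any $S$-proof $\pi$ of $\mathcal F$, outputs an interpolation circuit for $\mathcal F$ over the basis $\{0,1,\neg,\wedge,\vee\}$, of size polynomial in the size of $\pi$, which is monotone whenever $\vec p$ occurs only positively in $A$. **Calculi on clauses with literals $x,\neg x,x^*$.** Leaves are the clauses of the matrix. The rules are: * $\forall$-Red: from $D\vee u$ infer $D$, where $u$ is a universal literal that is not merged (not of the form $z^*$), and $\mathrm{ind}(u)\ge\mathrm{ind}(l)$ for all existential $l\in D$; $\forall$-Red$^*$: the same with $u^*$ in place of $u$. * Short resolution: from $C_1\vee x$ and $C_2\vee\neg x$ infer $C_1\vee C_2$, provided there is no $z\in C_1$ with $\neg z\in C_2$. * Long-distance resolution: from $C_1\vee U_1\vee x$ and $C_2\vee U_2\vee\neg x$ infer $C_1\vee C_2\vee\{u^*: u\in\mathrm{var}(U_1)\}$, provided that $l_1\in C_1$, $l_2\in C_2$ with the same variable satisfy $l_1=l_2$ and are not merged; $U_1,U_2$ consist of universal literals of index greater than $\mathrm{ind}(x)$ with $\mathrm{var}(U_1)=\mathrm{var}(U_2)$;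 and $w_1\in U_1$, $w_2\in U_2$ with the same variable $u$ satisfy $w_1=\neg w_2$, $w_1=u^*$ or $w_2=u^*$. (In each rule the displayed parts of a premise are disjoint.) *Q-Res*: short resolution on existential $x$, $\forall$-Red. *Tree-Q-Res*: Q-Res proofs in which each line is used at most once as a premise. *LD-Q-Res*: long-distance resolution on existential $x$, $\forall$-Red, $\forall$-Red$^*$. *QU-Res*: short resolution on existential or universal $x$, $\forall$-Red. *LQU$^+$-Res*: long-distance resolution on existential or universal $x$, $\forall$-Red, $\forall$-Red$^*$. **Calculi on annotated clauses.** Literals are $l^\sigma$ with $l$ existential and $\sigma$ a partial map from the universal variables to $\{0,1,*\}$. Write $l^{[\sigma]}$ for $l$ annotated by the restriction of $\sigma$ to variables $u$ with $\mathrm{ind}(u)<\mathrm{ind}(l)$; write $\sigma\circ\tau$ for $\sigma$ extended by $\tau$ outside the domain of $\sigma$; and let $\mathrm{inst}(\tau,C)=\{l^{[\sigma\circ\tau]}: l^\sigma\in C\}$. * *$\forall$Exp+Res*: the leaves are $\{l^{[\tau]}: l\in C\text{ existential}\}$, where $C$ is a clause of the matrix and $\tau$ is a $0/1$ assignment to all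 universal variables that falsifies every universal literal of $C$. The only rule is: from $x^\tau\vee C_1$ and $\neg x^\tau\vee C_2$ infer $C_1\cup C_2$. * *IR-calc*: the leaves are as above, but $\tau$ assigns only the universal variables of $C$, falsifying its universal literals. The rules are the same resolution rule, and instantiation: from $C$ infer $\mathrm{inst}(\tau,C)$, for a partial $0/1$ assignment $\tau$ to universal variables. * *IRM-calc*: leaves and instantiation as in IR-calc. Resolution: from $x^{\tau\cup\xi}\vee C_1$ and $\neg x^{\tau\cup\sigma}\vee C_2$ infer $\mathrm{inst}(\sigma,C_1)\cup\mathrm{inst}(\xi,C_2)$, where $\tau,\xi,\sigma$ have mutually disjoint domains and $\tau$ has values in $\{0,1\}$. Merging: from $C\vee b^\mu\vee b^\sigma$ with $\mathrm{dom}\,\mu=\mathrm{dom}\,\sigma$ infer $C\vee b^\xi$, where $\xi(u)=\mu(u)$ if $\mu(u)=\sigma(u)$, and $\xi(u)=*$ otherwise on the common domain. **Theorem.** LQU$^+$-Res and IRM-calc have monotone feasible interpolation. Moreover, for each of these two systems there is a computable procedure that, given $\mathcal F$ and any proof $\pi$ of $\mathcal F$, outputs an interpolation circuit for $\mathcal F$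 built from constants, $\wedge$, $\vee$ and selector gates $\mathrm{sel}(x,g_v,g_w)$ with $x\in\vec p$ (equal to $g_v$ if $x=0$ and to $g_w$ if $x=1$), of size polynomial in the size of $\pi$, such that whenever $\vec p$ occurs only positively in $A$, replacing each selector gate $\mathrm{sel}(x,g_v,g_w)$ by $(x\vee g_v)\wedge g_w$ gives a monotone interpolation circuit for $\mathcal F$. Both statements also hold for Tree-Q-Res, Q-Res, LD-Q-Res, QU-Res, $\forall$Exp+Res and IR-calc. -/

import Mathlib

namespace QBFInterpolation

/-! ## Quantified Boolean formulas -/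

/-- The two quantifiers. -/
inductive Quant
  | ex
  | all

/-- An ordinary literal over the variables `ℕ`: `(x, true)` is `x` and `(x, false)` is `¬ x`. -/
abbrev Lit := ℕ × Bool

/-- A conjunction of clauses; a clause is a list of literals, read as a disjunction. -/
abbrev CNF := List (List Lit)

/-- A quantifier prefix, outermost quantifier first. -/
abbrev Prefix := List (Quant × ℕ)

def IsEx (Q : Prefix) (x : ℕ) : Prop := (Quant.ex, x) ∈ Q

def IsAll (Q : Prefix) (x : ℕ) : Prop := (Quant.all, x) ∈ Q

/-- The index of a variable: its position in the prefix. -/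
def idx (Q : Prefix) (x : ℕ) : ℕ := (Q.map Prod.snd).idxOf x

/-- The assignment `α` satisfies every clause of `φ`. -/
def CNF.Sat (φ : CNF) (α : ℕ → Bool) : Prop := ∀ C ∈ φ, ∃ l ∈ C, α l.1 = l.2

/-- `QTrue Q φ α`: the formula `Q. φ` is true when its free variables are read off from `α`. -/
def QTrue : Prefix → CNF → (ℕ → Bool) → Prop
  | [], φ, α => CNF.Sat φ α
  | (Quant.ex, x) :: Q, φ, α => ∃ b : Bool, QTrue Q φ (Function.update α x b)
  | (Quant.all, x) :: Q, φ, α => ∀ b : Bool, QTrue Q φ (Function.update α x b)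

/-- The data of a formula `∃ p 𝒬 q 𝒬 r. [A(p, q) ∧ B(p, r)]`. -/
structure Instance where
  p : List ℕ
  q : Prefix
  r : Prefix
  A : CNF
  B : CNF

namespace Instance

/-- The prefix `∃ p 𝒬 q 𝒬 r`. -/
def pre (F : Instance) : Prefix := F.p.map (fun x => (Quant.ex, x)) ++ F.q ++ F.r

/-- The matrix `A ∧ B`. -/
def matrix (F : Instance) : CNF := F.A ++ F.B

/-- No variable is quantified twice (so `p`, `q`, `r` are mutually disjoint), `A` is over `p, q`,
`B` is over `p, r`, and no clause of the matrix is tautological. -/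
structure WellFormed (F : Instance) : Prop where
  nodup : (F.pre.map Prod.snd).Nodup
  varsA : ∀ C ∈ F.A, ∀ l ∈ C, l.1 ∈ F.p ∨ l.1 ∈ F.q.map Prod.snd
  varsB : ∀ C ∈ F.B, ∀ l ∈ C, l.1 ∈ F.p ∨ l.1 ∈ F.r.map Prod.snd
  nontaut : ∀ C ∈ F.matrix, ∀ x : ℕ, ¬ ((x, true) ∈ C ∧ (x, false) ∈ C)

/-- The variables `p` occur only positively in `A`. -/
def PositiveInA (F : Instance) : Prop := ∀ C ∈ F.A, ∀ x ∈ F.p, (x, false) ∉ C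

end Instance

/-! ## Proofs as labelled directed acyclic graphs -/

/-- How a line of a proof is obtained: it is a leaf, labelled by the `k`-th clause of the matrix; or
it is obtained from line `i` by a rule with one premise; or from lines `i`, `j` by a resolution rule
with pivot variable `x`, line `i` holding the positive and line `j` the negative pivot literal. -/
inductive Source
  | leaf (k : ℕ)
  | unary (i : ℕ)
  | res (i j x : ℕ)

/-- The premises of a line. -/
def Source.premises : Source → List ℕ
  | leaf _ => []
  | unary i => [i]
  | res i j _ => [i, j]

/-- A proof: the sequence of its lines, each one a clause (a list of literals of the calculus)
together with its origin. Its size is the number of lines. -/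
abbrev ProofGraph (Λ : Type) := List (List Λ × Source)

/-- A resolution calculus with literals `Λ`: its leaf rule (prefix, clause of the matrix, derived
line), its one-premise rules (prefix, premise, conclusion), its resolution rules (prefix, pivot
variable, positive premise, negative premise, conclusion), and a condition on the shape of the
proof. -/
structure Calculus (Λ : Type) where
  leafRule : Prefix → List Lit → List Λ → Prop
  unaryRule : Prefix → List Λ → List Λ → Prop
  resRule : Prefix → ℕ → List Λ → List Λ → List Λ → Prop
  shape : ProofGraph Λ → Prop

/-- Line `i` of `π` carries the clause `C`. -/
def ProofGraph.HasClause {Λ : Type} (π : ProofGraph Λ) (i : ℕ) (C : List Λ) : Prop :=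
  ∃ s, π[i]? = some (C, s)

/-- The clause `C` at line `i` of `π` is correctly obtained in the way `s` claims. -/
def Calculus.StepOK {Λ : Type} (S : Calculus Λ) (Q : Prefix) (φ : CNF) (π : ProofGraph Λ)
    (i : ℕ) (C : List Λ) : Source → Prop
  | Source.leaf k => ∃ D, φ[k]? = some D ∧ S.leafRule Q D C
  | Source.unary j => j < i ∧ ∃ D, π.HasClause j D ∧ S.unaryRule Q D C
  | Source.res j k x => j < i ∧ k < i ∧
      ∃ D E, π.HasClause j D ∧ π.HasClause k E ∧ S.resRule Q x D E C

/-- `π` is an `S`-refutation of `Q. φ`: every line is correct and the last one is the empty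
clause. -/
def Calculus.Refutes {Λ : Type} (S : Calculus Λ) (Q : Prefix) (φ : CNF) (π : ProofGraph Λ) :
    Prop :=
  (∀ i C s, π[i]? = some (C, s) → S.StepOK Q φ π i C s) ∧
  (∃ s, π.getLast? = some ([], s)) ∧ S.shape π

/-- Every line is used at most once as a premise. -/
def TreeLike {Λ : Type} (π : ProofGraph Λ) : Prop :=
  (π.flatMap fun n => n.2.premises).Nodup

/-- Clauses are read as sets of literals. -/
def litSet {Λ : Type} (C : List Λ) : Set Λ := {l | l ∈ C}

/-! ## The CDCL-based calculi -/

/-- The three kinds of literals over a variable `x`: `x`, `¬ x`, and the merged literal `x*`. -/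
inductive Sign
  | pos
  | neg
  | star

def Sign.compl : Sign → Sign
  | pos => neg
  | neg => pos
  | star => star

/-- A literal of the CDCL-based calculi. -/
abbrev MLit := ℕ × Sign

def Lit.toMLit (l : Lit) : MLit := (l.1, if l.2 then Sign.pos else Sign.neg)

namespace CDCL

/-- A leaf is a clause of the matrix. -/
def Leaf (_Q : Prefix) (C : List Lit) (D : List MLit) : Prop :=
  litSet D = Lit.toMLit '' litSet C

/-- Universal reduction `∀-Red`, from `D ∨ u` infer `D`, where `u` is a universal literal that is
not merged, and `ind(u) ≥ ind(l)` for all existential `l ∈ D`. -/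
def URed (Q : Prefix) (C D : Set MLit) : Prop :=
  ∃ l ∈ C, l.2 ≠ Sign.star ∧ IsAll Q l.1 ∧ D = C \ {l} ∧
    ∀ k ∈ D, IsEx Q k.1 → idx Q k.1 ≤ idx Q l.1

/-- `∀-Red*`, the same for a merged literal `u*`. -/
def URedStar (Q : Prefix) (C D : Set MLit) : Prop :=
  ∃ l ∈ C, l.2 = Sign.star ∧ IsAll Q l.1 ∧ D = C \ {l} ∧
    ∀ k ∈ D, IsEx Q k.1 → idx Q k.1 ≤ idx Q l.1

/-- Short-distance resolution on `x`: from `C₁ ∨ x` and `C₂ ∨ ¬ x` infer `C₁ ∨ C₂`, provided there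
is no `z ∈ C₁` with `¬ z ∈ C₂`. -/
def SRes (x : ℕ) (C D E : Set MLit) : Prop :=
  ∃ C₁ C₂ : Set MLit,
    (x, Sign.pos) ∉ C₁ ∧ C = C₁ ∪ {(x, Sign.pos)} ∧
    (x, Sign.neg) ∉ C₂ ∧ D = C₂ ∪ {(x, Sign.neg)} ∧
    (∀ z ∈ C₁, (z.1, z.2.compl) ∉ C₂) ∧
    E = C₁ ∪ C₂

/-- Long-distance resolution on `x`: from `C₁ ∨ U₁ ∨ x` and `C₂ ∨ U₂ ∨ ¬ x` infer `C₁ ∨ C₂ ∨ U`. -/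
def LRes (Q : Prefix) (x : ℕ) (C D E : Set MLit) : Prop :=
  ∃ C₁ U₁ C₂ U₂ : Set MLit,
    Disjoint C₁ U₁ ∧ (x, Sign.pos) ∉ C₁ ∪ U₁ ∧ C = C₁ ∪ U₁ ∪ {(x, Sign.pos)} ∧
    Disjoint C₂ U₂ ∧ (x, Sign.neg) ∉ C₂ ∪ U₂ ∧ D = C₂ ∪ U₂ ∪ {(x, Sign.neg)} ∧
    (∀ l₁ ∈ C₁, ∀ l₂ ∈ C₂, l₁.1 = l₂.1 → l₁ = l₂ ∧ l₁.2 ≠ Sign.star) ∧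
    (∀ l ∈ U₁ ∪ U₂, IsAll Q l.1 ∧ idx Q x < idx Q l.1) ∧
    Prod.fst '' U₁ = Prod.fst '' U₂ ∧
    (∀ w₁ ∈ U₁, ∀ w₂ ∈ U₂, w₁.1 = w₂.1 →
      w₁.2 = w₂.2.compl ∨ w₁.2 = Sign.star ∨ w₂.2 = Sign.star) ∧
    E = C₁ ∪ C₂ ∪ (fun u => (u, Sign.star)) '' (Prod.fst '' U₁)

end CDCL

/-- Q-resolution: short-distance resolution on existential pivots, `∀-Red`. -/
def qRes : Calculus MLit where
  leafRule := CDCL.Leaf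
  unaryRule Q C D := CDCL.URed Q (litSet C) (litSet D)
  resRule Q x C D E := IsEx Q x ∧ CDCL.SRes x (litSet C) (litSet D) (litSet E)
  shape _ := True

/-- Tree-like Q-resolution. -/
def treeQRes : Calculus MLit where
  leafRule := qRes.leafRule
  unaryRule := qRes.unaryRule
  resRule := qRes.resRule
  shape := TreeLike

/-- Long-distance Q-resolution: long-distance resolution on existential pivots, `∀-Red`,
`∀-Red*`. -/
def ldQRes : Calculus MLit where
  leafRule := CDCL.Leaf
  unaryRule Q C D :=
    CDCL.URed Q (litSet C) (litSet D) ∨ CDCL.URedStar Q (litSet C) (litSet D)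
  resRule Q x C D E := IsEx Q x ∧ CDCL.LRes Q x (litSet C) (litSet D) (litSet E)
  shape _ := True

/-- QU-resolution: short-distance resolution on existential or universal pivots, `∀-Red`. -/
def quRes : Calculus MLit where
  leafRule := CDCL.Leaf
  unaryRule Q C D := CDCL.URed Q (litSet C) (litSet D)
  resRule Q x C D E :=
    (IsEx Q x ∨ IsAll Q x) ∧ CDCL.SRes x (litSet C) (litSet D) (litSet E)
  shape _ := True

/-- LQU⁺-resolution: long-distance resolution on existential or universal pivots, `∀-Red`,
`∀-Red*`. -/
def lquPlusRes : Calculus MLit where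
  leafRule := CDCL.Leaf
  unaryRule Q C D :=
    CDCL.URed Q (litSet C) (litSet D) ∨ CDCL.URedStar Q (litSet C) (litSet D)
  resRule Q x C D E :=
    (IsEx Q x ∨ IsAll Q x) ∧ CDCL.LRes Q x (litSet C) (litSet D) (litSet E)
  shape _ := True

/-! ## The expansion-based calculi -/

/-- The values `0`, `1`, `*` of annotations. -/
inductive AVal
  | zero
  | one
  | star

/-- A written annotated literal: a literal with a list of pairs `(u, c)`, standing for `c/u`. -/
abbrev ALit := Lit × List (ℕ × AVal)

/-- A partial map from variables to `{0, 1, *}`. -/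
abbrev Ann := ℕ → Option AVal

/-- The annotated literal that is meant, independent of the way the annotation is written. -/
def ALit.denote (l : ALit) : Lit × Ann := (l.1, fun u => l.2.lookup u)

/-- The annotated clause that is meant. -/
def denote (C : List ALit) : Set (Lit × Ann) := ALit.denote '' litSet C

namespace Ann

/-- The domain of a partial map. -/
def dom (σ : Ann) : Set ℕ := {u | σ u ≠ none}

/-- All values of `σ` lie in `{0, 1}`. -/
def Binary (σ : Ann) : Prop := ∀ u, σ u ≠ some AVal.star

/-- The completion of `τ` by `μ`: `τ` where it is defined, otherwise `μ`. If the domains are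
disjoint, this is the union `τ ∪ μ`. -/
def complete (τ μ : Ann) : Ann := fun u => (τ u).or (μ u)

open Classical in
/-- The annotation `[σ]` of a literal over `x`: the part of `σ` on universal variables of smaller
index. -/
noncomputable def permitted (Q : Prefix) (x : ℕ) (σ : Ann) : Ann :=
  fun u => if IsAll Q u ∧ idx Q u < idx Q x then σ u else none

open Classical in
/-- The merge of two annotations with the same domain: common values are kept, different ones become
`*`. -/
noncomputable def merge (μ σ : Ann) : Ann :=
  fun u => if μ u = σ u then μ u else some AVal.star

end Ann

namespace Expansion

/-- `inst(τ, C) = { l^[σ completed by τ] | l^σ ∈ C }`. -/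
noncomputable def inst (Q : Prefix) (τ : Ann) (C : Set (Lit × Ann)) : Set (Lit × Ann) :=
  (fun l => (l.1, Ann.permitted Q l.1.1 (Ann.complete l.2 τ))) '' C

/-- The assignment that falsifies the universal literals of `C` and is undefined elsewhere. -/
def falsifier (Q : Prefix) (C : List Lit) (τ : Ann) : Prop :=
  ∀ u, (τ u = some AVal.zero ↔ IsAll Q u ∧ (u, true) ∈ C) ∧
    (τ u = some AVal.one ↔ IsAll Q u ∧ (u, false) ∈ C) ∧ τ u ≠ some AVal.star

/-- `{ l^[τ] | l ∈ C existential }`. -/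
def annotate (Q : Prefix) (τ : Ann) (C : List Lit) : Set (Lit × Ann) :=
  (fun l : Lit => (l, Ann.permitted Q l.1 τ)) '' {l | l ∈ C ∧ IsEx Q l.1}

/-- The leaf rule of IR-calc and IRM-calc. -/
def Leaf (Q : Prefix) (C : List Lit) (D : List ALit) : Prop :=
  ∃ τ : Ann, falsifier Q C τ ∧ denote D = annotate Q τ C

/-- The leaf rule of `∀Exp+Res`: the annotation comes from a `0/1` assignment to all universal
variables that falsifies the universal literals of the clause. -/
def LeafComplete (Q : Prefix) (C : List Lit) (D : List ALit) : Prop :=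
  ∃ τ : Ann, τ.Binary ∧ τ.dom = {u | IsAll Q u} ∧
    (∀ u, IsAll Q u → (u, true) ∈ C → τ u = some AVal.zero) ∧
    (∀ u, IsAll Q u → (u, false) ∈ C → τ u = some AVal.one) ∧
    denote D = annotate Q τ C

/-- Instantiation by a `0/1` assignment to universal variables. -/
def Instantiation (Q : Prefix) (C D : Set (Lit × Ann)) : Prop :=
  ∃ τ : Ann, τ.Binary ∧ τ.dom ⊆ {u | IsAll Q u} ∧ D = inst Q τ C

/-- Merging: from `C ∨ b^μ ∨ b^σ` with `dom μ = dom σ` infer `C ∨ b^ξ`, where `ξ` is the merge of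
`μ` and `σ`. -/
def Merging (C D : Set (Lit × Ann)) : Prop :=
  ∃ (b : Lit) (μ σ : Ann), (b, μ) ∈ C ∧ (b, σ) ∈ C ∧ μ.dom = σ.dom ∧
    D = (C \ {(b, μ), (b, σ)}) ∪ {(b, Ann.merge μ σ)}

/-- Resolution of `x^τ ∨ C₁` and `¬ x^τ ∨ C₂` to `C₁ ∪ C₂`. -/
def Res (x : ℕ) (C D E : Set (Lit × Ann)) : Prop :=
  ∃ τ : Ann, ((x, true), τ) ∈ C ∧ ((x, false), τ) ∈ D ∧
    E = (C \ {((x, true), τ)}) ∪ (D \ {((x, false), τ)})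

/-- Resolution of `x^(τ ∪ ξ) ∨ C₁` and `¬ x^(τ ∪ σ) ∨ C₂` to `inst(σ, C₁) ∪ inst(ξ, C₂)`, where the
domains of `τ`, `ξ`, `σ` are mutually disjoint and `τ` has values in `{0, 1}`. -/
def MRes (Q : Prefix) (x : ℕ) (C D E : Set (Lit × Ann)) : Prop :=
  ∃ τ ξ σ : Ann, Disjoint τ.dom ξ.dom ∧ Disjoint τ.dom σ.dom ∧ Disjoint ξ.dom σ.dom ∧
    τ.Binary ∧
    ((x, true), Ann.complete τ ξ) ∈ C ∧ ((x, false), Ann.complete τ σ) ∈ D ∧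
    E = inst Q σ (C \ {((x, true), Ann.complete τ ξ)}) ∪
      inst Q ξ (D \ {((x, false), Ann.complete τ σ)})

end Expansion

/-- The calculus `∀Exp+Res`. -/
def forallExpRes : Calculus ALit where
  leafRule := Expansion.LeafComplete
  unaryRule _ _ _ := False
  resRule _ x C D E := Expansion.Res x (denote C) (denote D) (denote E)
  shape _ := True

/-- The calculus IR-calc. -/
def irCalc : Calculus ALit where
  leafRule := Expansion.Leaf
  unaryRule Q C D := Expansion.Instantiation Q (denote C) (denote D)
  resRule _ x C D E := Expansion.Res x (denote C) (denote D) (denote E)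
  shape _ := True

/-- The calculus IRM-calc. -/
def irmCalc : Calculus ALit where
  leafRule := Expansion.Leaf
  unaryRule Q C D :=
    Expansion.Instantiation Q (denote C) (denote D) ∨ Expansion.Merging (denote C) (denote D)
  resRule Q x C D E := Expansion.MRes Q x (denote C) (denote D) (denote E)
  shape _ := True

/-! ## Boolean circuits -/

/-- A gate. The arguments `i`, `j` are the positions of earlier gates, `x` is an input variable.
`sel x i j` has the value of gate `i` if `x = 0` and of gate `j` if `x = 1`;
`orAnd x i j` is the monotone connective `(x ∨ gᵢ) ∧ gⱼ`. -/
inductive Gate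
  | const (b : Bool)
  | input (x : ℕ)
  | not (i : ℕ)
  | and (i j : ℕ)
  | or (i j : ℕ)
  | sel (x i j : ℕ)
  | orAnd (x i j : ℕ)

namespace Gate

/-- The value of a gate, given the input and the list `vs` of the values of the earlier gates. -/
def eval (α : ℕ → Bool) (vs : List Bool) : Gate → Bool
  | const b => b
  | input x => α x
  | not i => !(vs.getD i false)
  | and i j => vs.getD i false && vs.getD j false
  | or i j => vs.getD i false || vs.getD j false
  | sel x i j => if α x then vs.getD j false else vs.getD i false
  | orAnd x i j => (α x || vs.getD i false) && vs.getD j false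

/-- The gates that feed a gate. -/
def args : Gate → List ℕ
  | const _ => []
  | input _ => []
  | not i => [i]
  | and i j => [i, j]
  | or i j => [i, j]
  | sel _ i j => [i, j]
  | orAnd _ i j => [i, j]

/-- The input variables that a gate reads. -/
def inputs : Gate → List ℕ
  | input x => [x]
  | sel x _ _ => [x]
  | orAnd x _ _ => [x]
  | _ => []

/-- The usual basis: constants, inputs, `¬`, `∧`, `∨`. -/
def IsStandard : Gate → Prop
  | sel _ _ _ => False
  | orAnd _ _ _ => False
  | _ => True

/-- The basis of selector circuits: constants, `∧`, `∨`, `sel`. -/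
def IsSelector : Gate → Prop
  | const _ => True
  | and _ _ => True
  | or _ _ => True
  | sel _ _ _ => True
  | _ => False

/-- The monotone gates: all but `¬` and `sel`. -/
def IsMonotone : Gate → Prop
  | not _ => False
  | sel _ _ _ => False
  | _ => True

/-- Replace a selector gate `sel(x, g, h)` by `(x ∨ g) ∧ h`; leave other gates unchanged. -/
def replaceSel : Gate → Gate
  | sel x i j => orAnd x i j
  | g => g

end Gate

/-- A circuit is the list of its gates in topological order; the last gate is the output. Its size
is the number of gates. -/
abbrev Circuit := List Gate

namespace Circuit

/-- The values of all gates. -/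
def values (α : ℕ → Bool) (G : Circuit) : List Bool :=
  G.foldl (fun vs g => vs ++ [g.eval α vs]) []

/-- The value of the output gate. -/
def eval (G : Circuit) (α : ℕ → Bool) : Bool := (values α G).getLastD false

/-- There is an output gate and every gate is fed by earlier gates only. -/
def WellFormed (G : Circuit) : Prop :=
  G ≠ [] ∧ ∀ i g, G[i]? = some g → ∀ j ∈ Gate.args g, j < i

def IsStandard (G : Circuit) : Prop := ∀ g ∈ G, Gate.IsStandard g

def IsSelector (G : Circuit) : Prop := ∀ g ∈ G, Gate.IsSelector g

def IsMonotone (G : Circuit) : Prop := ∀ g ∈ G, Gate.IsMonotone g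

/-- Replace every selector gate `sel(x, g, h)` by `(x ∨ g) ∧ h`. -/
def replaceSel (G : Circuit) : Circuit := G.map Gate.replaceSel

end Circuit

/-- `G` is an interpolation circuit for `F`: its inputs are among `p`, and for every assignment to
`p`, if `G` outputs `0` then `𝒬 q. A` is false, and if `G` outputs `1` then `𝒬 r. B` is false.
(The values of `α` outside `p` do not matter for a well-formed `F`.) -/
def IsInterpolationCircuit (F : Instance) (G : Circuit) : Prop :=
  G.WellFormed ∧ (∀ g ∈ G, ∀ x ∈ Gate.inputs g, x ∈ F.p) ∧
  ∀ α : ℕ → Bool,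
    (G.eval α = false → ¬ QTrue F.q F.A α) ∧ (G.eval α = true → ¬ QTrue F.r F.B α)

/-! ## Encodings, needed to speak of computable functions on formulas, proofs and circuits -/

def quantEquiv : Quant ≃ Bool where
  toFun
    | Quant.ex => false
    | Quant.all => true
  invFun
    | false => Quant.ex
    | true => Quant.all
  left_inv a := by cases a <;> rfl
  right_inv a := by cases a <;> rfl

instance : Primcodable Quant := Primcodable.ofEquiv Bool quantEquiv

def signEquiv : Sign ≃ Option Bool where
  toFun
    | Sign.pos => some true
    | Sign.neg => some false
    | Sign.star => none
  invFun
    | some true => Sign.pos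
    | some false => Sign.neg
    | none => Sign.star
  left_inv a := by cases a <;> rfl
  right_inv a := by rcases a with _ | _ | _ <;> rfl

instance : Primcodable Sign := Primcodable.ofEquiv (Option Bool) signEquiv

def avalEquiv : AVal ≃ Option Bool where
  toFun
    | AVal.zero => some false
    | AVal.one => some true
    | AVal.star => none
  invFun
    | some false => AVal.zero
    | some true => AVal.one
    | none => AVal.star
  left_inv a := by cases a <;> rfl
  right_inv a := by rcases a with _ | _ | _ <;> rfl

instance : Primcodable AVal := Primcodable.ofEquiv (Option Bool) avalEquiv

def instanceEquiv : Instance ≃ List ℕ × Prefix × Prefix × CNF × CNF where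
  toFun F := (F.p, F.q, F.r, F.A, F.B)
  invFun t := ⟨t.1, t.2.1, t.2.2.1, t.2.2.2.1, t.2.2.2.2⟩
  left_inv _ := rfl
  right_inv _ := rfl

instance : Primcodable Instance := Primcodable.ofEquiv _ instanceEquiv

def sourceEquiv : Source ≃ ℕ ⊕ ℕ ⊕ (ℕ × ℕ × ℕ) where
  toFun
    | Source.leaf k => Sum.inl k
    | Source.unary i => Sum.inr (Sum.inl i)
    | Source.res i j x => Sum.inr (Sum.inr (i, j, x))
  invFun
    | Sum.inl k => Source.leaf k
    | Sum.inr (Sum.inl i) => Source.unary i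
    | Sum.inr (Sum.inr t) => Source.res t.1 t.2.1 t.2.2
  left_inv a := by cases a <;> rfl
  right_inv a := by rcases a with _ | _ | _ <;> rfl

instance : Primcodable Source := Primcodable.ofEquiv _ sourceEquiv

def gateEquiv : Gate ≃
    Bool ⊕ ℕ ⊕ ℕ ⊕ (ℕ × ℕ) ⊕ (ℕ × ℕ) ⊕ (ℕ × ℕ × ℕ) ⊕ (ℕ × ℕ × ℕ) where
  toFun
    | Gate.const b => Sum.inl b
    | Gate.input x => Sum.inr (Sum.inl x)
    | Gate.not i => Sum.inr (Sum.inr (Sum.inl i))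
    | Gate.and i j => Sum.inr (Sum.inr (Sum.inr (Sum.inl (i, j))))
    | Gate.or i j => Sum.inr (Sum.inr (Sum.inr (Sum.inr (Sum.inl (i, j)))))
    | Gate.sel x i j => Sum.inr (Sum.inr (Sum.inr (Sum.inr (Sum.inr (Sum.inl (x, i, j))))))
    | Gate.orAnd x i j => Sum.inr (Sum.inr (Sum.inr (Sum.inr (Sum.inr (Sum.inr (x, i, j))))))
  invFun
    | Sum.inl b => Gate.const b
    | Sum.inr (Sum.inl x) => Gate.input x
    | Sum.inr (Sum.inr (Sum.inl i)) => Gate.not i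
    | Sum.inr (Sum.inr (Sum.inr (Sum.inl t))) => Gate.and t.1 t.2
    | Sum.inr (Sum.inr (Sum.inr (Sum.inr (Sum.inl t)))) => Gate.or t.1 t.2
    | Sum.inr (Sum.inr (Sum.inr (Sum.inr (Sum.inr (Sum.inl t))))) => Gate.sel t.1 t.2.1 t.2.2
    | Sum.inr (Sum.inr (Sum.inr (Sum.inr (Sum.inr (Sum.inr t))))) => Gate.orAnd t.1 t.2.1 t.2.2
  left_inv a := by cases a <;> rfl
  right_inv a := by rcases a with _ | _ | _ | _ | _ | _ | _ <;> rfl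

instance : Primcodable Gate := Primcodable.ofEquiv _ gateEquiv

/-! ## Monotone feasible interpolation -/

/-- `S` has monotone feasible interpolation: some effective procedure turns every `S`-refutation `π`
of a formula `F = ∃ p 𝒬 q 𝒬 r. [A(p, q) ∧ B(p, r)]` into an interpolation circuit for `F`, over the
usual basis and of size polynomial in the size of `π`, and this circuit is monotone whenever `p`
occurs only positively in `A`. -/
def HasMonotoneFeasibleInterpolation {Λ : Type} [Primcodable Λ] (S : Calculus Λ) : Prop :=
  ∃ extract : Instance × ProofGraph Λ → Circuit, Computable extract ∧
  ∃ P : Polynomial ℕ, ∀ (F : Instance) (π : ProofGraph Λ), F.WellFormed →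
    S.Refutes F.pre F.matrix π →
      IsInterpolationCircuit F (extract (F, π)) ∧
      (extract (F, π)).IsStandard ∧
      (extract (F, π)).length ≤ P.eval π.length ∧
      (F.PositiveInA → (extract (F, π)).IsMonotone)

/-- Some effective procedure turns every `S`-refutation `π` of a formula
`F = ∃ p 𝒬 q 𝒬 r. [A(p, q) ∧ B(p, r)]` into an interpolation circuit for `F`, built from constants,
`∧`, `∨` and selector gates and of size polynomial in the size of `π`, such that whenever `p` occurs
only positively in `A`, replacing every selector gate `sel(x, g, h)` by `(x ∨ g) ∧ h` gives a
monotone interpolation circuit for `F`. -/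
def MonotoneBySelectorReplacement {Λ : Type} [Primcodable Λ] (S : Calculus Λ) : Prop :=
  ∃ extract : Instance × ProofGraph Λ → Circuit, Computable extract ∧
  ∃ P : Polynomial ℕ, ∀ (F : Instance) (π : ProofGraph Λ), F.WellFormed →
    S.Refutes F.pre F.matrix π →
      IsInterpolationCircuit F (extract (F, π)) ∧
      (extract (F, π)).IsSelector ∧
      (extract (F, π)).length ≤ P.eval π.length ∧
      (F.PositiveInA →
        IsInterpolationCircuit F (extract (F, π)).replaceSel ∧
        (extract (F, π)).replaceSel.IsMonotone)

end QBFInterpolation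

namespace QBFInterpolation

/-! Fix an assignment `α` to the common variables. Each line of the proof gets a bit, `false` for
the side of `A` and `true` for the side of `B`. The invariant is: if `α` falsifies the literals of
the line over `p`, then the line is a sound consequence of that side alone, the literals of the
other side being ignored. A leaf takes the side of its clause. If the pivot is not quantified on the
side of a premise, it is invisible there, and this premise alone yields the resolvent. So a pivot in
`q` gets an or gate: one premise on side `B` suffices, otherwise both are on side `A` and are
resolved there. Dually, a pivot in `r` gets an and gate. A pivot in `p` gets a selector for the
premise whose pivot literal `α` falsifies. At the empty clause the bit names a false side.

If `p` occurs only positively in `A`, negative literals over `p` need not be falsified on side `A`.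
The gate `(x ∨ g) ∧ h` differs from the selector only for `x = 0`, `g = 1`, `h = 0`. There it
answers `A`, which the premise with the true literal `¬ x` justifies.

What remains is a meaning of "consequence" under which merged literals and annotations are sound.
Both versions of `Entails` are defined by recursion along the prefix of one side, so restriction to
a side is built in. With merged literals, a universal variable `u` may be given a value after which
the clause is no longer needed, or, if `u*` is in the clause, some value that keeps the clause; or
else every value must satisfy a literal or lead on. With annotations, either the literals not
mentioning `u` suffice for both values, or one value suffices for the literals whose annotation of
`u` is that value or `*`. Soundness is carried by `CDCL.Entails.reduce` and
`CDCL.ResolvesTo.entails`, and by `Expansion.Entails.lift` and `Expansion.Entails.resolve`;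
`Reading.holds` runs the induction over the proof for both readings. The weaker systems are reduced
to LQU⁺-Res, and all annotated ones to `Expansion.calculus`.

Besides `F`, the circuits depend only on the origins of the lines, not on their clauses. So they are
primitive recursive and spend one or five gates per line. -/

/-- The prefix is listed by strictly increasing values of `ι`. -/
def SortedBy (ι : ℕ → ℕ) (Q : Prefix) : Prop := Q.Pairwise fun a b => ι a.2 < ι b.2

/-! ### Prefixes listed by increasing index -/

section Sorted

variable {ι : ℕ → ℕ} {a : Quant × ℕ} {Q : Prefix}

theorem SortedBy.tail (h : SortedBy ι (a :: Q)) : SortedBy ι Q := (List.pairwise_cons.1 h).2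

theorem SortedBy.lt (h : SortedBy ι (a :: Q)) {x : ℕ} (hx : x ∈ Q.map Prod.snd) :
    ι a.2 < ι x := by
  obtain ⟨b, hb, rfl⟩ := List.mem_map.1 hx
  exact (List.pairwise_cons.1 h).1 b hb

theorem SortedBy.notMem (h : SortedBy ι (a :: Q)) : a.2 ∉ Q.map Prod.snd :=
  fun hx => lt_irrefl _ (h.lt hx)

theorem IsEx.mem {x : ℕ} (h : IsEx Q x) : x ∈ Q.map Prod.snd := List.mem_map.2 ⟨_, h, rfl⟩

theorem IsAll.mem {x : ℕ} (h : IsAll Q x) : x ∈ Q.map Prod.snd := List.mem_map.2 ⟨_, h, rfl⟩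

theorem IsEx.cons {x : ℕ} (h : IsEx Q x) : IsEx (a :: Q) x := List.mem_cons_of_mem _ h

theorem IsAll.cons {x : ℕ} (h : IsAll Q x) : IsAll (a :: Q) x := List.mem_cons_of_mem _ h

theorem mem_vars_iff {x : ℕ} : x ∈ Q.map Prod.snd ↔ IsEx Q x ∨ IsAll Q x := by
  refine ⟨fun h => ?_, fun h => h.elim IsEx.mem IsAll.mem⟩
  obtain ⟨⟨q, y⟩, hb, rfl⟩ := List.mem_map.1 h
  cases q
  · exact Or.inl hb
  · exact Or.inr hb

theorem SortedBy.not_isAll_of_isEx (h : SortedBy ι Q) {x : ℕ} (he : IsEx Q x) : ¬ IsAll Q x := by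
  induction Q with
  | nil => simp [IsEx] at he
  | cons b Q ih =>
    intro ha
    rcases List.mem_cons.1 he with he' | he' <;> rcases List.mem_cons.1 ha with ha' | ha'
    · cases he'.trans ha'.symm
    · exact h.notMem (he' ▸ IsAll.mem ha')
    · exact h.notMem (ha' ▸ IsEx.mem he')
    · exact ih h.tail he' ha'

end Sorted

/-! ### Semantics of clauses with merged literals -/

namespace CDCL

/-- No variable occurs in two literals of the clause. -/
def Consistent (C : Set MLit) : Prop := ∀ l ∈ C, ∀ k ∈ C, l.1 = k.1 → l = k

/-- A strategy-free reading of clauses: `Entails φ Q α C` says that, once the variables outside `Q`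
are read off from `α`, the formula `Q. φ` is refuted as soon as `C` is falsified; a merged literal
stands for one value of its variable that may depend on the earlier variables. -/
def Entails (φ : CNF) : Prefix → (ℕ → Bool) → Set MLit → Prop
  | [], α, _ => ¬ φ.Sat α
  | (Quant.ex, x) :: Q, α, C =>
      ∀ b, Lit.toMLit (x, b) ∈ C ∨ Entails φ Q (Function.update α x b) C
  | (Quant.all, u) :: Q, α, C =>
      (∃ b, Entails φ Q (Function.update α u b) ∅) ∨
      ((u, Sign.star) ∈ C ∧ ∃ b, Entails φ Q (Function.update α u b) C) ∨
      ∀ b, Lit.toMLit (u, b) ∈ C ∨ Entails φ Q (Function.update α u b) C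

variable {φ : CNF} {ι : ℕ → ℕ} {Q : Prefix} {α : ℕ → Bool} {C D E : Set MLit}

/-- With no literal that could be satisfied, each alternative at a universal variable provides a
value that refutes the rest, and both values of an existential variable do. This turns the empty
last line into the falsity of one side. -/
theorem Entails.not_qTrue (h : Entails φ Q α ∅) : ¬ QTrue Q φ α := by
  induction Q generalizing α with
  | nil => exact h
  | cons a Q ih =>
    obtain ⟨q, x⟩ := a
    cases q
    · rintro ⟨b, hb⟩
      exact ih ((h b).resolve_left id) hb
    · intro hq
      obtain ⟨b, hb⟩ | ⟨h, -⟩ | h := h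
      · exact ih hb (hq b)
      · exact h
      · exact ih ((h true).resolve_left id) (hq true)

theorem toMLit_inj {x : ℕ} {b c : Bool} (h : Lit.toMLit (x, b) = Lit.toMLit (x, c)) :
    b = c := by
  cases b <;> cases c <;> simp_all [Lit.toMLit]

theorem toMLit_ne_star (l : Lit) : (Lit.toMLit l).2 ≠ Sign.star := by
  rcases l with ⟨x, _ | _⟩ <;> simp [Lit.toMLit]

/-- Only literals over the quantified variables matter, and universal literals may become
merged. -/
theorem Entails.lift (hQ : SortedBy ι Q) (hC : Consistent C)
    (hCD : ∀ l ∈ C, l.1 ∈ Q.map Prod.snd → l ∈ D ∨ IsAll Q l.1 ∧ (l.1, Sign.star) ∈ D)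
    (h : Entails φ Q α C) : Entails φ Q α D := by
  induction Q generalizing α with
  | nil => exact h
  | cons a Q ih =>
    have ih' : ∀ {β}, Entails φ Q β C → Entails φ Q β D := by
      refine fun {β} => ih hQ.tail fun l hl hlQ => ?_
      refine (hCD l hl (List.mem_cons_of_mem _ hlQ)).imp id fun ⟨h1, h2⟩ => ⟨?_, h2⟩
      rcases List.mem_cons.1 h1 with h1 | h1
      · exact absurd (h1 ▸ hlQ) hQ.notMem
      · exact h1
    obtain ⟨q, x⟩ := a
    cases q
    · intro b
      refine (h b).imp (fun hb => ?_) ih'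
      refine (hCD _ hb (List.mem_cons_self ..)).resolve_right fun h1 => ?_
      exact hQ.not_isAll_of_isEx (x := x) (List.mem_cons_self ..) h1.1
    · obtain h | ⟨h, b, hb⟩ | h := h
      · exact Or.inl h
      · exact Or.inr (Or.inl ⟨(hCD _ h (List.mem_cons_self ..)).elim id And.right, b, ih' hb⟩)
      · by_cases hx : (x, Sign.star) ∈ D ∧ ∃ b, Lit.toMLit (x, b) ∈ C
        · obtain ⟨hx, b, hb⟩ := hx
          -- The merged literal of `D` stands for the value `!b`: by consistency, no literal of `C`
          -- is satisfied by it.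
          refine Or.inr (Or.inl ⟨hx, !b, ih' ((h !b).resolve_left fun hb' => ?_)⟩)
          have := toMLit_inj (hC _ hb _ hb' rfl)
          simp at this
        · refine Or.inr (Or.inr fun b => (h b).imp (fun hb => ?_) ih')
          exact (hCD _ hb (List.mem_cons_self ..)).resolve_right fun h1 => hx ⟨h1.2, b, hb⟩

/-- A clause of the matrix is entailed. -/
theorem Entails.of_mem {K : List Lit} (hK : K ∈ φ) (hQ : SortedBy ι Q)
    (h : ∀ l ∈ K, if l.1 ∈ Q.map Prod.snd then Lit.toMLit l ∈ C else α l.1 ≠ l.2) :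
    Entails φ Q α C := by
  induction Q generalizing α with
  | nil =>
    intro hS
    obtain ⟨l, hl, hl'⟩ := hS K hK
    have := h l hl
    simp only [List.map_nil, List.not_mem_nil, if_false] at this
    exact this hl'
  | cons a Q ih =>
    -- A value that satisfies no literal of `C` falsifies the literals of `K` over this variable, so
    -- they join those falsified by the assignment.
    have key : ∀ b, Lit.toMLit (a.2, b) ∈ C ∨ Entails φ Q (Function.update α a.2 b) C := by
      intro b
      by_cases hb : Lit.toMLit (a.2, b) ∈ C
      · exact Or.inl hb
      refine Or.inr (ih hQ.tail fun l hl => ?_)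
      have hl' := h l hl
      by_cases hla : l.1 = a.2
      · have hnot : l.1 ∉ Q.map Prod.snd := hla ▸ hQ.notMem
        have hmem : l.1 ∈ (a :: Q).map Prod.snd := by rw [hla]; exact List.mem_cons_self ..
        rw [if_pos hmem] at hl'
        rw [if_neg hnot, hla, Function.update_self]
        rintro rfl
        exact hb (by rwa [← hla])
      · have : l.1 ∈ (a :: Q).map Prod.snd ↔ l.1 ∈ Q.map Prod.snd := by
          simp only [List.map_cons, List.mem_cons, hla, false_or]
        rwa [Function.update_of_ne hla, ← if_congr this rfl rfl]
    obtain ⟨q, x⟩ := a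
    cases q
    · exact key
    · exact Or.inr (Or.inr key)

/-- Consistency gives each universal variable a value that satisfies no literal of the clause.
Choosing these values, one never ends in a satisfied literal, so the clause can be dropped
altogether. -/
theorem Entails.of_no_existential (hQ : SortedBy ι Q) (hC : Consistent C)
    (hex : ∀ l ∈ C, ¬ IsEx Q l.1) (h : Entails φ Q α C) : Entails φ Q α ∅ := by
  induction Q generalizing α with
  | nil => exact h
  | cons a Q ih =>
    have ih' : ∀ {β}, Entails φ Q β C → Entails φ Q β ∅ :=
      fun {β} => ih hQ.tail fun l hl hlQ => hex l hl hlQ.cons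
    obtain ⟨q, x⟩ := a
    cases q
    · exact fun b => Or.inr (ih' ((h b).resolve_left fun hb => hex _ hb (List.mem_cons_self ..)))
    · obtain h | ⟨h, b, hb⟩ | h := h
      · exact Or.inl h
      · exact Or.inl ⟨b, ih' hb⟩
      · by_cases ht : Lit.toMLit (x, true) ∈ C
        · refine Or.inl ⟨false, ih' ((h false).resolve_left fun hf => ?_)⟩
          exact Bool.noConfusion (toMLit_inj (hC _ ht _ hf rfl))
        · exact Or.inl ⟨true, ih' ((h true).resolve_left ht)⟩

theorem Consistent.mono (hD : Consistent D) (h : C ⊆ D) : Consistent C :=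
  fun l hl k hk => hD l (h hl) k (h hk)

/-- Soundness of universal reduction. -/
theorem Entails.reduce (hQ : SortedBy ι Q) (hC : Consistent C) {l : MLit} (hl : l ∈ C)
    (hu : ¬ IsEx Q l.1) (hidx : ∀ k ∈ C \ {l}, IsEx Q k.1 → ι k.1 ≤ ι l.1)
    (h : Entails φ Q α C) : Entails φ Q α (C \ {l}) := by
  induction Q generalizing α with
  | nil => exact h
  | cons a Q ih =>
    have ih' : ∀ {β}, Entails φ Q β C → Entails φ Q β (C \ {l}) := fun {β} =>
      ih hQ.tail (fun h => hu h.cons) fun k hk hkQ => hidx k hk hkQ.cons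
    obtain ⟨q, x⟩ := a
    cases q
    · intro b
      refine (h b).imp (fun hb => ⟨hb, ?_⟩) ih'
      rintro rfl
      exact hu (List.mem_cons_self ..)
    · by_cases hx : l.1 = x
      · have hno : ∀ k ∈ C, ¬ IsEx Q k.1 := by
          intro k hk hkQ
          have hlt := hQ.lt (IsEx.mem hkQ)
          by_cases hkl : k = l
          · subst hkl
            rw [hx] at hlt
            exact lt_irrefl _ hlt
          · have := hidx k ⟨hk, hkl⟩ hkQ.cons
            rw [hx] at this
            exact absurd hlt (not_lt.2 this)
        obtain h | ⟨-, b, hb⟩ | h := h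
        · exact Or.inl h
        · exact Or.inl ⟨b, hb.of_no_existential hQ.tail hC hno⟩
        · by_cases ht : Lit.toMLit (x, true) ∈ C
          · refine Or.inl ⟨false, .of_no_existential hQ.tail hC hno
              ((h false).resolve_left fun hf => ?_)⟩
            exact Bool.noConfusion (toMLit_inj (hC _ ht _ hf rfl))
          · exact Or.inl ⟨true, ((h true).resolve_left ht).of_no_existential hQ.tail hC hno⟩
      · have hmem : ∀ {s}, (x, s) ∈ C → (x, s) ∈ C \ {l} := fun hs => ⟨hs, by rintro rfl; exact hx rfl⟩
        obtain h | ⟨h, b, hb⟩ | h := h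
        · exact Or.inl h
        · exact Or.inr (Or.inl ⟨hmem h, b, ih' hb⟩)
        · exact Or.inr (Or.inr fun b => (h b).imp hmem ih')

/-- Long-distance resolution applied to consistent clauses: what the soundness proof needs. -/
structure ResolvesTo (ι : ℕ → ℕ) (isAll : ℕ → Prop) (x : ℕ) (C D E : Set MLit) : Prop where
  left : ∀ l ∈ C, l ≠ (x, Sign.pos) → l ∈ E ∨ isAll l.1 ∧ ι x < ι l.1 ∧ (l.1, Sign.star) ∈ E
  right : ∀ l ∈ D, l ≠ (x, Sign.neg) → l ∈ E ∨ isAll l.1 ∧ ι x < ι l.1 ∧ (l.1, Sign.star) ∈ E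
  pos : (x, Sign.pos) ∈ C
  neg : (x, Sign.neg) ∈ D
  star : ∀ u s, (u, Sign.star) ∈ C → (u, s) ∈ D → ι x < ι u
  star' : ∀ u s, (u, Sign.star) ∈ D → (u, s) ∈ C → ι x < ι u

variable {isAll : ℕ → Prop} {x : ℕ}

/-- A pivot that is not quantified in `Q` is invisible to `Entails`, so one premise suffices. This
serves pivots outside the current side as well as the part of the prefix behind the pivot. -/
theorem ResolvesTo.lift_left (h : ResolvesTo ι isAll x C D E) (hQ : SortedBy ι Q)
    (hall : ∀ y ∈ Q.map Prod.snd, isAll y → IsAll Q y) (hC : Consistent C)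
    (hx : x ∉ Q.map Prod.snd) (hCα : Entails φ Q α C) : Entails φ Q α E := by
  refine hCα.lift hQ hC fun l hl hlQ => ?_
  refine (h.left l hl ?_).imp id fun h1 => ⟨hall _ hlQ h1.1, h1.2.2⟩
  rintro rfl
  exact hx hlQ

theorem ResolvesTo.lift_right (h : ResolvesTo ι isAll x C D E) (hQ : SortedBy ι Q)
    (hall : ∀ y ∈ Q.map Prod.snd, isAll y → IsAll Q y) (hD : Consistent D)
    (hx : x ∉ Q.map Prod.snd) (hDα : Entails φ Q α D) : Entails φ Q α E := by
  refine hDα.lift hQ hD fun l hl hlQ => ?_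
  refine (h.right l hl ?_).imp id fun h1 => ⟨hall _ hlQ h1.1, h1.2.2⟩
  rintro rfl
  exact hx hlQ

/-- Soundness of long-distance resolution. -/
theorem ResolvesTo.entails (h : ResolvesTo ι isAll x C D E) (hQ : SortedBy ι Q)
    (hall : ∀ y ∈ Q.map Prod.snd, isAll y → IsAll Q y) (hC : Consistent C) (hD : Consistent D)
    (hCα : Entails φ Q α C) (hDα : Entails φ Q α D) : Entails φ Q α E := by
  induction Q generalizing α with
  | nil => exact hCα
  | cons a Q ih =>
    by_cases hxQ : x ∈ (a :: Q).map Prod.snd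
    swap
    · exact h.lift_left hQ hall hC hxQ hCα
    have hall' : ∀ y ∈ Q.map Prod.snd, isAll y → IsAll Q y := by
      intro y hy hy'
      rcases List.mem_cons.1 (hall y (List.mem_cons_of_mem _ hy) hy') with h1 | h1
      · exact absurd (h1 ▸ hy) hQ.notMem
      · exact h1
    by_cases hax : a.2 = x
    · have hxt : x ∉ Q.map Prod.snd := hax ▸ hQ.notMem
      -- The value `0` of the pivot is left to `C` and the value `1` to `D`: by consistency the
      -- premise lacks the opposite pivot literal, so that branch cannot end in a satisfied literal.
      have pivot : (∀ b, Lit.toMLit (x, b) ∈ C ∨ Entails φ Q (Function.update α x b) C) →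
          (∀ b, Lit.toMLit (x, b) ∈ D ∨ Entails φ Q (Function.update α x b) D) →
          ∀ b, Entails φ Q (Function.update α x b) E := by
        rintro h1 h2 (_ | _)
        · refine h.lift_left hQ.tail hall' hC hxt ((h1 false).resolve_left fun hf => ?_)
          simpa [Lit.toMLit] using hC _ h.pos _ hf rfl
        · refine h.lift_right hQ.tail hall' hD hxt ((h2 true).resolve_left fun hf => ?_)
          simpa [Lit.toMLit] using hD _ h.neg _ hf rfl
      obtain ⟨q, y⟩ := a
      obtain rfl : y = x := hax
      cases q
      · exact fun b => Or.inr (pivot hCα hDα b)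
      · obtain h1 | ⟨h1, -⟩ | h1 := hCα
        · exact Or.inl h1
        · simpa using hC _ h.pos _ h1 rfl
        obtain h2 | ⟨h2, -⟩ | h2 := hDα
        · exact Or.inl h2
        · simpa using hD _ h.neg _ h2 rfl
        · exact Or.inr (Or.inr fun b => Or.inr (pivot h1 h2 b))
    · have hxt : x ∈ Q.map Prod.snd := by
        rcases List.mem_cons.1 hxQ with h1 | h1
        · exact absurd h1.symm hax
        · exact h1
      have hlt : ¬ ι x < ι a.2 := not_lt.2 (hQ.lt hxt).le
      -- To the left of the pivot nothing gets merged, so literals pass to `E` unchanged.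
      have hl : ∀ s, (a.2, s) ∈ C → (a.2, s) ∈ E := fun s hs =>
        (h.left _ hs fun he => hax (congrArg Prod.fst he)).resolve_right fun h1 => hlt h1.2.1
      have hr : ∀ s, (a.2, s) ∈ D → (a.2, s) ∈ E := fun s hs =>
        (h.right _ hs fun he => hax (congrArg Prod.fst he)).resolve_right fun h1 => hlt h1.2.1
      have ih' : ∀ {β}, Entails φ Q β C → Entails φ Q β D → Entails φ Q β E :=
        fun {β} => ih hQ.tail hall'
      have merge : (∀ b, Lit.toMLit (a.2, b) ∈ C ∨ Entails φ Q (Function.update α a.2 b) C) →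
          (∀ b, Lit.toMLit (a.2, b) ∈ D ∨ Entails φ Q (Function.update α a.2 b) D) →
          ∀ b, Lit.toMLit (a.2, b) ∈ E ∨ Entails φ Q (Function.update α a.2 b) E := by
        intro h1 h2 b
        obtain h1 | h1 := h1 b
        · exact Or.inl (hl _ h1)
        obtain h2 | h2 := h2 b
        · exact Or.inl (hr _ h2)
        · exact Or.inr (ih' h1 h2)
      obtain ⟨q, v⟩ := a
      cases q
      · exact merge hCα hDα
      · obtain h1 | ⟨h1, b, hb⟩ | h1 := hCα
        · exact Or.inl h1
        · have hvD : ∀ s, (v, s) ∉ D := fun s hs => hlt (h.star _ _ h1 hs)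
          obtain h2 | ⟨h2, -⟩ | h2 := hDα
          · exact Or.inl h2
          · exact absurd h2 (hvD _)
          · exact Or.inr (Or.inl ⟨hl _ h1, b, ih' hb ((h2 b).resolve_left (hvD _))⟩)
        obtain h2 | ⟨h2, b, hb⟩ | h2 := hDα
        · exact Or.inl h2
        · have hvC : ∀ s, (v, s) ∉ C := fun s hs => hlt (h.star' _ _ h2 hs)
          exact Or.inr (Or.inl ⟨hr _ h2, b, ih' ((h1 b).resolve_left (hvC _)) hb⟩)
        · exact Or.inr (Or.inr (merge h1 h2))

/-- Long-distance resolution of consistent clauses. -/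
theorem LRes.resolvesTo {P : Prefix} (h : LRes P x C D E) (hC : Consistent C)
    (hD : Consistent D) : ResolvesTo (idx P) (IsAll P) x C D E ∧ Consistent E := by
  obtain ⟨C₁, U₁, C₂, U₂, dC, hxC, rfl, dD, hxD, rfl, hCC, hU, hvar, hw, rfl⟩ := h
  have hU2 : ∀ l ∈ U₂, ∃ k ∈ U₁, k.1 = l.1 := fun l hl => by
    have : l.1 ∈ Prod.fst '' U₁ := hvar ▸ ⟨l, hl, rfl⟩
    exact this
  have hU1 : ∀ l ∈ U₁, ∃ k ∈ U₂, k.1 = l.1 := fun l hl => by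
    have : l.1 ∈ Prod.fst '' U₂ := hvar ▸ ⟨l, hl, rfl⟩
    exact this
  -- In a consistent clause equal variables mean equal literals, so disjoint parts have disjoint
  -- sets of variables.
  have hCU : ∀ l ∈ C₁, ∀ k ∈ U₁, l.1 ≠ k.1 := fun l hl k hk he =>
    Set.disjoint_left.1 dC hl (hC l (Or.inl (Or.inl hl)) k (Or.inl (Or.inr hk)) he ▸ hk)
  have hDU : ∀ l ∈ C₂, ∀ k ∈ U₂, l.1 ≠ k.1 := fun l hl k hk he =>
    Set.disjoint_left.1 dD hl (hD l (Or.inl (Or.inl hl)) k (Or.inl (Or.inr hk)) he ▸ hk)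
  refine ⟨⟨?_, ?_, ?_, ?_, ?_, ?_⟩, ?_⟩
  · rintro l ((hl | hl) | hl) hne
    · exact Or.inl (Or.inl (Or.inl hl))
    · exact Or.inr ⟨(hU l (Or.inl hl)).1, (hU l (Or.inl hl)).2, Or.inr ⟨_, ⟨l, hl, rfl⟩, rfl⟩⟩
    · exact absurd hl hne
  · rintro l ((hl | hl) | hl) hne
    · exact Or.inl (Or.inl (Or.inr hl))
    · refine Or.inr ⟨(hU l (Or.inr hl)).1, (hU l (Or.inr hl)).2, Or.inr ⟨_, ?_, rfl⟩⟩
      exact hvar ▸ ⟨l, hl, rfl⟩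
    · exact absurd hl hne
  · exact Or.inr rfl
  · exact Or.inr rfl
  -- A merged literal of `C₁` cannot share its variable with `D`, so `u*` comes from `U₁` and lies
  -- to the right of the pivot.
  · rintro u s ((hl | hl) | hl) hs
    · rcases hs with (hs | hs) | hs
      · exact absurd rfl (hCC _ hl _ hs rfl).2
      · obtain ⟨k, hk, hke⟩ := hU2 _ hs
        exact absurd hke.symm (hCU _ hl _ hk)
      · obtain ⟨rfl, -⟩ := Prod.mk.inj hs
        simpa using hC _ (Or.inr rfl) _ (Or.inl (Or.inl hl)) rfl
    · exact (hU _ (Or.inl hl)).2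
    · simp at hl
  · rintro u s ((hl | hl) | hl) hs
    · rcases hs with (hs | hs) | hs
      · have := hCC _ hs _ hl rfl
        exact absurd (congrArg Prod.snd this.1) this.2
      · obtain ⟨k, hk, hke⟩ := hU1 _ hs
        exact absurd hke.symm (hDU _ hl _ hk)
      · obtain ⟨rfl, -⟩ := Prod.mk.inj hs
        simpa using hD _ (Or.inr rfl) _ (Or.inl (Or.inl hl)) rfl
    · exact (hU _ (Or.inr hl)).2
    · simp at hl
  · have hCs : ∀ l ∈ C₁ ∪ C₂, ∀ k ∈ U₁, l.1 ≠ k.1 := by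
      rintro l (hl | hl) k hk
      · exact hCU l hl k hk
      · obtain ⟨k', hk', he⟩ := hU1 _ hk
        exact he ▸ hDU l hl k' hk'
    rintro l (hl | ⟨_, ⟨l, hl, rfl⟩, rfl⟩) k (hk | ⟨_, ⟨k, hk, rfl⟩, rfl⟩) he
    · rcases hl with hl | hl <;> rcases hk with hk | hk
      · exact hC l (Or.inl (Or.inl hl)) k (Or.inl (Or.inl hk)) he
      · exact (hCC l hl k hk he).1
      · exact (hCC k hk l hl he.symm).1.symm
      · exact hD l (Or.inl (Or.inl hl)) k (Or.inl (Or.inl hk)) he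
    · exact absurd he (hCs l hl k hk)
    · exact absurd he.symm (hCs k hk l hl)
    · exact Prod.ext he rfl

/-- Without merged literals, short-distance resolution is long-distance resolution. -/
theorem SRes.lRes {P : Prefix} (h : SRes x C D E) (hC : ∀ l ∈ C, l.2 ≠ Sign.star)
    (hD : ∀ l ∈ D, l.2 ≠ Sign.star) : LRes P x C D E := by
  obtain ⟨C₁, C₂, hxC, rfl, hxD, rfl, hz, rfl⟩ := h
  refine ⟨C₁, ∅, C₂, ∅, by simp, by simpa using hxC, by simp, by simp, by simpa using hxD, by simp,
    ?_, by simp, rfl, by simp, by simp⟩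
  rintro ⟨y, s⟩ hl ⟨z, t⟩ hk (rfl : y = z)
  have hs := hC _ (Or.inl hl)
  have ht := hD _ (Or.inl hk)
  refine ⟨?_, hs⟩
  have := hz _ hl
  cases s <;> cases t <;> simp_all [Sign.compl]

end CDCL

/-! ### Semantics of annotated clauses -/

namespace Expansion

/-- The annotation value for an assigned Boolean. -/
def boolVal (b : Bool) : AVal := if b then AVal.one else AVal.zero

theorem boolVal_injective : Function.Injective boolVal := by
  intro b c h
  cases b <;> cases c <;> first | rfl | cases h

/-- The literals whose annotation does not mention `u`. -/
def unmarked (u : ℕ) (C : Set (Lit × Ann)) : Set (Lit × Ann) := {l | l ∈ C ∧ l.2 u = none}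

/-- The literals whose annotation is compatible with the value `b` of `u`, and mentions `u`. -/
def marked (u : ℕ) (b : Bool) (C : Set (Lit × Ann)) : Set (Lit × Ann) :=
  {l | l ∈ C ∧ (l.2 u = some (boolVal b) ∨ l.2 u = some AVal.star)}

/-- `Entails φ Q α C`: once the variables outside `Q` are read off from `α`, the formula `Q. φ` is
refuted as soon as `C` is falsified. For a universal variable `u`, either the literals that do not
mention `u` suffice for both values of `u`, or one value of `u` suffices for the literals that
mention `u`. -/
def Entails (φ : CNF) : Prefix → (ℕ → Bool) → Set (Lit × Ann) → Prop
  | [], α, _ => ¬ φ.Sat α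
  | (Quant.ex, x) :: Q, α, C =>
      ∀ b, (∃ σ, ((x, b), σ) ∈ C) ∨ Entails φ Q (Function.update α x b) C
  | (Quant.all, u) :: Q, α, C =>
      (∀ b, Entails φ Q (Function.update α u b) (unmarked u C)) ∨
      ∃ b, Entails φ Q (Function.update α u b) (marked u b C)

/-- The annotation value `c` is kept, or it becomes `*`. -/
def Coarsens (c d : Option AVal) : Prop := d = c ∨ c ≠ none ∧ d = some AVal.star

/-- After instantiation by `τ` and merging, the clause `C` becomes a part of `D`, as far as the
variables of `Q` are concerned. -/
def Embeds (ι : ℕ → ℕ) (Q : Prefix) (τ : Ann) (C D : Set (Lit × Ann)) : Prop :=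
  ∀ l ∈ C, IsEx Q l.1.1 → ∃ σ, (l.1, σ) ∈ D ∧
    ∀ u, IsAll Q u → ι u < ι l.1.1 → Coarsens ((l.2 u).or (τ u)) (σ u)

variable {φ : CNF} {ι : ℕ → ℕ} {Q : Prefix} {α : ℕ → Bool} {τ ξ σ : Ann}
  {C D E : Set (Lit × Ann)}

theorem Coarsens.eq_none {d : Option AVal} (h : Coarsens none d) : d = none :=
  h.elim id fun h => absurd rfl h.1

theorem Coarsens.compatible {c : AVal} {d : Option AVal} {b : Bool} (h : Coarsens (some c) d)
    (hc : c = boolVal b ∨ c = AVal.star) : d = some (boolVal b) ∨ d = some AVal.star := by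
  rcases h with rfl | ⟨-, rfl⟩
  · rcases hc with rfl | rfl
    · exact Or.inl rfl
    · exact Or.inr rfl
  · exact Or.inr rfl

theorem exists_compatible (c : AVal) : ∃ b, c = boolVal b ∨ c = AVal.star := by
  cases c
  · exact ⟨false, Or.inl rfl⟩
  · exact ⟨true, Or.inl rfl⟩
  -- For `*` either value would do.
  · exact ⟨true, Or.inr rfl⟩

theorem compatible_of_marked {o : Option AVal} {b : Bool}
    (h : o = some (boolVal b) ∨ o = some AVal.star) :
    ∃ c, o = some c ∧ (c = boolVal b ∨ c = AVal.star) :=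
  h.elim (fun h => ⟨_, h, Or.inl rfl⟩) fun h => ⟨_, h, Or.inr rfl⟩

theorem Entails.not_qTrue (h : Entails φ Q α ∅) : ¬ QTrue Q φ α := by
  induction Q generalizing α with
  | nil => exact h
  | cons a Q ih =>
    obtain ⟨q, x⟩ := a
    cases q
    · rintro ⟨b, hb⟩
      exact ih ((h b).resolve_left fun ⟨_, h⟩ => h) hb
    · intro hq
      have h1 : ∀ u, unmarked u ∅ = ∅ := fun u => by simp [unmarked]
      have h2 : ∀ u b, marked u b ∅ = ∅ := fun u b => by simp [marked]
      obtain h | ⟨b, hb⟩ := h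
      · exact ih (h1 x ▸ h true) (hq true)
      · exact ih (h2 x b ▸ hb) (hq b)

theorem Embeds.tail {a : Quant × ℕ} (h : Embeds ι (a :: Q) τ C D) : Embeds ι Q τ C D :=
  fun l hl hlQ => (h l hl hlQ.cons).imp fun _ h => ⟨h.1, fun u hu => h.2 u hu.cons⟩

section Restrict

variable {u : ℕ}

theorem Embeds.unmarked (hQ : SortedBy ι ((Quant.all, u) :: Q))
    (h : Embeds ι ((Quant.all, u) :: Q) τ C D) (hτ : τ u = none) :
    Embeds ι Q τ (unmarked u C) (unmarked u D) := by
  intro l hl hlQ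
  obtain ⟨σ, hσ, h1⟩ := h l hl.1 hlQ.cons
  refine ⟨σ, ⟨hσ, ?_⟩, fun v hv => h1 v hv.cons⟩
  have := h1 u (List.mem_cons_self ..) (hQ.lt hlQ.mem)
  rw [hl.2, hτ] at this
  exact this.eq_none

/-- Instantiation turns literals that do not mention `u` into literals that carry the value of `τ`
there. They survive the restriction to any `b` compatible with it; for `*` this is any `b`. -/
theorem Embeds.unmarked_marked (hQ : SortedBy ι ((Quant.all, u) :: Q))
    (h : Embeds ι ((Quant.all, u) :: Q) τ C D) {c : AVal} {b : Bool} (hτ : τ u = some c)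
    (hc : c = boolVal b ∨ c = AVal.star) :
    Embeds ι Q τ (Expansion.unmarked u C) (marked u b D) := by
  intro l hl hlQ
  obtain ⟨σ, hσ, h1⟩ := h l hl.1 hlQ.cons
  refine ⟨σ, ⟨hσ, ?_⟩, fun v hv => h1 v hv.cons⟩
  have := h1 u (List.mem_cons_self ..) (hQ.lt hlQ.mem)
  rw [hl.2, hτ] at this
  exact this.compatible hc

theorem Embeds.marked (hQ : SortedBy ι ((Quant.all, u) :: Q))
    (h : Embeds ι ((Quant.all, u) :: Q) τ C D) (b : Bool) :
    Embeds ι Q τ (marked u b C) (marked u b D) := by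
  intro l hl hlQ
  obtain ⟨σ, hσ, h1⟩ := h l hl.1 hlQ.cons
  refine ⟨σ, ⟨hσ, ?_⟩, fun v hv => h1 v hv.cons⟩
  obtain ⟨c, hlc, hc⟩ := compatible_of_marked hl.2
  have := h1 u (List.mem_cons_self ..) (hQ.lt hlQ.mem)
  rw [hlc] at this
  exact this.compatible hc

end Restrict

/-- Soundness of instantiation and merging. -/
theorem Entails.lift (hQ : SortedBy ι Q) (hCD : Embeds ι Q τ C D) (h : Entails φ Q α C) :
    Entails φ Q α D := by
  induction Q generalizing α C D with
  | nil => exact h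
  | cons a Q ih =>
    obtain ⟨q, x⟩ := a
    cases q
    · refine fun b => (h b).imp ?_ (ih hQ.tail hCD.tail)
      rintro ⟨σ, hσ⟩
      obtain ⟨σ', h1, -⟩ := hCD _ hσ (List.mem_cons_self ..)
      exact ⟨σ', h1⟩
    · obtain h | ⟨b, hb⟩ := h
      · cases hτ : τ x with
        | none => exact Or.inl fun b => ih hQ.tail (hCD.unmarked hQ hτ) (h b)
        | some c =>
          -- The premise refutes for both values of `x`; after instantiation only one compatible
          -- with `τ x` is kept.
          obtain ⟨b, hb⟩ := exists_compatible c
          exact Or.inr ⟨b, ih hQ.tail (hCD.unmarked_marked hQ hτ hb) (h b)⟩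
      · exact Or.inr ⟨b, ih hQ.tail (hCD.marked hQ b) hb⟩

/-- Soundness of resolution with merged annotations. -/
theorem Entails.resolve {x : ℕ} (hQ : SortedBy ι Q) (hτ : τ.Binary) (hξσ : Disjoint ξ.dom σ.dom)
    (hC : Embeds ι Q σ (C \ {((x, true), τ.complete ξ)}) E)
    (hD : Embeds ι Q ξ (D \ {((x, false), τ.complete σ)}) E)
    (hCα : Entails φ Q α C) (hDα : Entails φ Q α D) : Entails φ Q α E := by
  induction Q generalizing α C D E with
  | nil => exact hCα
  | cons a Q ih =>
    have hdiff : ∀ {R : Prefix} {l : Lit × Ann}, ¬ IsEx R x → IsEx R l.1.1 → ∀ {m : Ann} {b : Bool},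
        l ≠ ((x, b), m) := by
      rintro R l hx hl m b rfl
      exact hx hl
    by_cases hxQ : IsEx (a :: Q) x
    swap
    · exact hCα.lift hQ fun l hl hlQ => hC l ⟨hl, hdiff hxQ hlQ⟩ hlQ
    obtain ⟨q, y⟩ := a
    cases q
    · intro b
      by_cases hyx : y = x
      · subst hyx
        have hyQ : ¬ IsEx Q y := fun h => hQ.notMem h.mem
        -- The value `0` of the pivot is left to `C` and `1` to `D`. A literal satisfied by that
        -- value is not the removed pivot literal, so it reaches `E`.
        cases b
        · refine (hCα false).imp (fun ⟨ρ, hρ⟩ => ?_) fun h => h.lift hQ.tail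
            fun l hl hlQ => hC.tail l ⟨hl, hdiff hyQ hlQ⟩ hlQ
          obtain ⟨ρ', h1, -⟩ := hC _ ⟨hρ, by simp⟩ hxQ
          exact ⟨ρ', h1⟩
        · refine (hDα true).imp (fun ⟨ρ, hρ⟩ => ?_) fun h => h.lift hQ.tail
            fun l hl hlQ => hD.tail l ⟨hl, hdiff hyQ hlQ⟩ hlQ
          obtain ⟨ρ', h1, -⟩ := hD _ ⟨hρ, by simp⟩ hxQ
          exact ⟨ρ', h1⟩
      · obtain ⟨ρ, hρ⟩ | h1 := hCα b
        · obtain ⟨ρ', h1, -⟩ := hC _ ⟨hρ, by simp [hyx]⟩ (List.mem_cons_self ..)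
          exact Or.inl ⟨ρ', h1⟩
        obtain ⟨ρ, hρ⟩ | h2 := hDα b
        · obtain ⟨ρ', h1, -⟩ := hD _ ⟨hρ, by simp [hyx]⟩ (List.mem_cons_self ..)
          exact Or.inl ⟨ρ', h1⟩
        · exact Or.inr (ih hQ.tail hC.tail hD.tail h1 h2)
    · have hyC : ∀ {K : Set (Lit × Ann)} {k : Lit × Ann}, k.2 y ≠ none →
          unmarked y (K \ {k}) = unmarked y K := by
        intro K k hk
        ext l
        refine ⟨fun h => ⟨h.1.1, h.2⟩, fun h => ⟨⟨h.1, ?_⟩, h.2⟩⟩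
        rintro rfl
        exact hk h.2
      have hmC : ∀ {K : Set (Lit × Ann)} {k : Lit × Ann} {b : Bool},
          ¬ (k.2 y = some (boolVal b) ∨ k.2 y = some AVal.star) →
          marked y b (K \ {k}) = marked y b K := by
        intro K k b hk
        ext l
        refine ⟨fun h => ⟨h.1.1, h.2⟩, fun h => ⟨⟨h.1, ?_⟩, h.2⟩⟩
        rintro rfl
        exact hk h.2
      have hu : ∀ {K : Set (Lit × Ann)} {k : Lit × Ann},
          unmarked y K \ {k} = unmarked y (K \ {k}) := by
        intro K k
        ext l
        exact ⟨fun h => ⟨⟨h.1.1, h.2⟩, h.1.2⟩, fun h => ⟨⟨h.1.1, h.2⟩, h.1.2⟩⟩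
      have hm : ∀ {K : Set (Lit × Ann)} {k : Lit × Ann} {b : Bool},
          marked y b K \ {k} = marked y b (K \ {k}) := by
        intro K k b
        ext l
        exact ⟨fun h => ⟨⟨h.1.1, h.2⟩, h.1.2⟩, fun h => ⟨⟨h.1.1, h.2⟩, h.1.2⟩⟩
      -- Otherwise the premise entails the conclusion without its pivot literal.
      have pivotC : (τ.complete ξ y = none ∧
            ∀ b, Entails φ Q (Function.update α y b) (unmarked y C)) ∨
          (∃ b, (τ.complete ξ y = some (boolVal b) ∨ τ.complete ξ y = some AVal.star) ∧
            Entails φ Q (Function.update α y b) (marked y b C)) ∨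
          Entails φ ((Quant.all, y) :: Q) α E := by
        obtain h | ⟨b, h⟩ := hCα
        · by_cases hp : τ.complete ξ y = none
          · exact Or.inl ⟨hp, h⟩
          · exact Or.inr (Or.inr (Entails.lift hQ hC (Or.inl fun b => by rw [hyC hp]; exact h b)))
        · by_cases hp : τ.complete ξ y = some (boolVal b) ∨ τ.complete ξ y = some AVal.star
          · exact Or.inr (Or.inl ⟨b, hp, h⟩)
          · exact Or.inr (Or.inr (Entails.lift hQ hC (Or.inr ⟨b, by rw [hmC hp]; exact h⟩)))
      have pivotD : (τ.complete σ y = none ∧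
            ∀ b, Entails φ Q (Function.update α y b) (unmarked y D)) ∨
          (∃ b, (τ.complete σ y = some (boolVal b) ∨ τ.complete σ y = some AVal.star) ∧
            Entails φ Q (Function.update α y b) (marked y b D)) ∨
          Entails φ ((Quant.all, y) :: Q) α E := by
        obtain h | ⟨b, h⟩ := hDα
        · by_cases hp : τ.complete σ y = none
          · exact Or.inl ⟨hp, h⟩
          · exact Or.inr (Or.inr (Entails.lift hQ hD (Or.inl fun b => by rw [hyC hp]; exact h b)))
        · by_cases hp : τ.complete σ y = some (boolVal b) ∨ τ.complete σ y = some AVal.star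
          · exact Or.inr (Or.inl ⟨b, hp, h⟩)
          · exact Or.inr (Or.inr (Entails.lift hQ hD (Or.inr ⟨b, by rw [hmC hp]; exact h⟩)))
      have hor : ∀ ρ : Ann, τ.complete ρ y = (τ y).or (ρ y) := fun _ => rfl
      -- In the remaining cases both pivot literals survive the restriction at `y`. If only one of
      -- them mentions `y`, it does so through `ξ` or `σ`, and the other premise is instantiated by
      -- just that map. So both premises move to the same value of `y`.
      obtain ⟨hc, h1⟩ | ⟨b, hc, h1⟩ | h := pivotC
      · rw [hor, Option.or_eq_none_iff] at hc
        obtain ⟨hd, h2⟩ | ⟨b, hd, h2⟩ | h := pivotD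
        · rw [hor, Option.or_eq_none_iff] at hd
          exact Or.inl fun b => ih hQ.tail (hu ▸ hC.unmarked hQ hd.2) (hu ▸ hD.unmarked hQ hc.2)
            (h1 b) (h2 b)
        · rw [hor, hc.1, Option.none_or] at hd
          obtain ⟨c, hσ, hcb⟩ := compatible_of_marked hd
          exact Or.inr ⟨b, ih hQ.tail (hu ▸ hC.unmarked_marked hQ hσ hcb) (hm ▸ hD.marked hQ b)
            (h1 b) h2⟩
        · exact h
      · obtain ⟨hd, h2⟩ | ⟨b', hd, h2⟩ | h := pivotD
        · rw [hor, Option.or_eq_none_iff] at hd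
          rw [hor, hd.1, Option.none_or] at hc
          obtain ⟨c, hξ, hcb⟩ := compatible_of_marked hc
          exact Or.inr ⟨b, ih hQ.tail (hm ▸ hC.marked hQ b) (hu ▸ hD.unmarked_marked hQ hξ hcb)
            h1 (h2 b)⟩
        -- Both pivot annotations mention `y`. As `ξ` and `σ` have disjoint domains, `τ y` is
        -- defined, and being `0` or `1` it forces a common value.
        · obtain rfl : b = b' := by
            rw [hor] at hc hd
            cases hτy : τ y with
            | none =>
              rw [hτy, Option.none_or] at hc hd
              have hξ : ξ y ≠ none := by rcases hc with hc | hc <;> rw [hc] <;> simp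
              have hσ : σ y ≠ none := by rcases hd with hd | hd <;> rw [hd] <;> simp
              exact absurd hσ (Set.disjoint_left.1 hξσ hξ)
            | some c =>
              have hcs : c ≠ AVal.star := by
                rintro rfl
                exact hτ y hτy
              rw [hτy, Option.some_or, Option.some_inj, Option.some_inj] at hc hd
              have := (hc.resolve_right hcs).symm.trans (hd.resolve_right hcs)
              exact boolVal_injective this
          exact Or.inr ⟨b, ih hQ.tail (hm ▸ hC.marked hQ b) (hm ▸ hD.marked hQ b) h1 h2⟩
        · exact h
      · exact h

/-- Soundness of the leaf rules. -/
theorem Entails.of_mem {K : List Lit} (hK : K ∈ φ) (hQ : SortedBy ι Q) (hτ : τ.Binary)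
    (hex : ∀ l ∈ K, IsEx Q l.1 → ∃ σ, (l, σ) ∈ C ∧ ∀ u, IsAll Q u → ι u < ι l.1 → σ u = τ u)
    (hall : ∀ l ∈ K, IsAll Q l.1 → τ l.1 = some (boolVal !l.2))
    (hout : ∀ l ∈ K, l.1 ∉ Q.map Prod.snd → α l.1 ≠ l.2) : Entails φ Q α C := by
  induction Q generalizing α C with
  | nil =>
    intro hS
    obtain ⟨l, hl, hl'⟩ := hS K hK
    exact hout l hl (by simp) hl'
  | cons a Q ih =>
    have hout' : ∀ b, (∀ l ∈ K, l.1 = a.2 → b ≠ l.2) →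
        ∀ l ∈ K, l.1 ∉ Q.map Prod.snd → Function.update α a.2 b l.1 ≠ l.2 := by
      intro b hb l hl hlQ
      by_cases hla : l.1 = a.2
      · rw [hla, Function.update_self]
        exact hb l hl hla
      · rw [Function.update_of_ne hla]
        exact hout l hl (by simpa [hla] using hlQ)
    obtain ⟨q, x⟩ := a
    cases q
    · intro b
      by_cases hb : (x, b) ∈ K
      · obtain ⟨σ, hσ, -⟩ := hex _ hb (List.mem_cons_self ..)
        exact Or.inl ⟨σ, hσ⟩
      · refine Or.inr (ih hQ.tail (fun l hl hlQ => ?_) (fun l hl hlQ => hall l hl hlQ.cons)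
          (hout' b fun l hl hlx hbl => hb ?_))
        · exact (hex l hl hlQ.cons).imp fun σ h => ⟨h.1, fun u hu => h.2 u hu.cons⟩
        · have hlx' : l.1 = x := hlx
          rwa [hbl, ← hlx']
    · have hx : IsAll ((Quant.all, x) :: Q) x := List.mem_cons_self ..
      cases hτx : τ x with
      | none =>
        -- Where `τ` is undefined, `K` has no literal over `x`, so both values are harmless.
        -- Otherwise the value given by `τ` falsifies the literals of `K` over `x`.
        refine Or.inl fun b => ih hQ.tail (fun l hl hlQ => ?_)
          (fun l hl hlQ => hall l hl hlQ.cons) (hout' b fun l hl hlx => ?_)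
        · obtain ⟨σ, hσ, h⟩ := hex l hl hlQ.cons
          exact ⟨σ, ⟨hσ, (h x hx (hQ.lt hlQ.mem)).trans hτx⟩, fun u hu => h u hu.cons⟩
        · have hlx' : l.1 = x := hlx
          have := hall l hl (hlx' ▸ hx)
          rw [hlx', hτx] at this
          cases this
      | some c =>
        obtain ⟨b, hb⟩ := exists_compatible c
        have hb := hb.resolve_right fun h => hτ x (h ▸ hτx)
        refine Or.inr ⟨b, ih hQ.tail (fun l hl hlQ => ?_)
          (fun l hl hlQ => hall l hl hlQ.cons) (hout' b fun l hl hlx => ?_)⟩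
        · obtain ⟨σ, hσ, h⟩ := hex l hl hlQ.cons
          exact ⟨σ, ⟨hσ, Or.inl ((h x hx (hQ.lt hlQ.mem)).trans (hb ▸ hτx))⟩,
            fun u hu => h u hu.cons⟩
        · have hlx' : l.1 = x := hlx
          have := hall l hl (hlx' ▸ hx)
          rw [hlx', hτx, hb, Option.some_inj] at this
          rintro rfl
          exact Bool.not_ne_self _ (boolVal_injective this).symm

end Expansion

/-! ### Interpolation along a proof -/

/-! ### The two sides of an instance -/

namespace Instance

/-- The prefix of the second block that belongs to `A` (`false`) or to `B` (`true`). -/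
def sidePrefix (F : Instance) : Bool → Prefix
  | false => F.q
  | true => F.r

/-- The part `A` (`false`) or `B` (`true`) of the matrix. -/
def sideCNF (F : Instance) : Bool → CNF
  | false => F.A
  | true => F.B

variable {F : Instance}

theorem sidePrefix_sublist (F : Instance) (s : Bool) : (F.sidePrefix s).Sublist F.pre := by
  cases s
  · exact ((List.sublist_append_right _ _).trans (List.sublist_append_left _ _))
  · exact List.sublist_append_right _ _

/-- Since no variable is repeated, the index is the actual position. The blocks `q` and `r` inherit
the order as sublists, so the soundness lemmas apply to each side with the global index. -/
theorem WellFormed.sortedBy_pre (hF : F.WellFormed) : SortedBy (idx F.pre) F.pre := by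
  refine List.pairwise_iff_getElem.2 fun i j hi hj hij => ?_
  have key : ∀ (k : ℕ) (hk : k < F.pre.length), idx F.pre (F.pre[k]).2 = k := by
    intro k hk
    have := hF.nodup.idxOf_getElem k (by simpa using hk)
    simpa [idx] using this
  rw [key i hi, key j hj]
  exact hij

theorem WellFormed.sortedBy (hF : F.WellFormed) (s : Bool) :
    SortedBy (idx F.pre) (F.sidePrefix s) :=
  hF.sortedBy_pre.sublist (F.sidePrefix_sublist s)

theorem WellFormed.isEx_of_mem_p {x : ℕ} (hx : x ∈ F.p) : IsEx F.pre x :=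
  List.mem_append_left _ (List.mem_append_left _ (List.mem_map.2 ⟨x, hx, rfl⟩))

theorem WellFormed.not_isAll_of_mem_p (hF : F.WellFormed) {x : ℕ} (hx : x ∈ F.p) :
    ¬ IsAll F.pre x :=
  hF.sortedBy_pre.not_isAll_of_isEx (isEx_of_mem_p hx)

theorem isEx_pre {x : ℕ} {s : Bool} (h : IsEx (F.sidePrefix s) x) : IsEx F.pre x :=
  (F.sidePrefix_sublist s).subset h

theorem isAll_pre {x : ℕ} {s : Bool} (h : IsAll (F.sidePrefix s) x) : IsAll F.pre x :=
  (F.sidePrefix_sublist s).subset h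

theorem WellFormed.isAll_side (hF : F.WellFormed) {x : ℕ} {s : Bool}
    (hx : x ∈ (F.sidePrefix s).map Prod.snd) (h : IsAll F.pre x) : IsAll (F.sidePrefix s) x :=
  (mem_vars_iff.1 hx).resolve_left fun he => hF.sortedBy_pre.not_isAll_of_isEx (isEx_pre he) h

theorem WellFormed.notMem_side (hF : F.WellFormed) {x : ℕ} (hx : x ∈ F.p) (s : Bool) :
    x ∉ (F.sidePrefix s).map Prod.snd := by
  have h := hF.nodup
  simp only [pre, List.map_append, List.map_map, List.append_assoc] at h
  have hd := (List.nodup_append'.1 h).2.2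
  have hx' : x ∈ F.p.map (Prod.snd ∘ fun x => (Quant.ex, x)) := List.mem_map.2 ⟨x, hx, rfl⟩
  intro hs
  refine hd hx' (List.mem_append.2 ?_)
  cases s
  · exact Or.inl hs
  · exact Or.inr hs

theorem WellFormed.notMem_r (hF : F.WellFormed) {x : ℕ} (hx : x ∈ F.q.map Prod.snd) :
    x ∉ F.r.map Prod.snd := by
  have h := hF.nodup
  simp only [pre, List.map_append, List.map_map, List.append_assoc] at h
  exact (List.nodup_append'.1 (List.nodup_append'.1 h).2.1).2.2 hx

theorem WellFormed.vars_side (hF : F.WellFormed) {s : Bool} {K : List Lit}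
    (hK : K ∈ F.sideCNF s) {l : Lit} (hl : l ∈ K) :
    l.1 ∈ F.p ∨ l.1 ∈ (F.sidePrefix s).map Prod.snd := by
  cases s
  · exact hF.varsA K hK l hl
  · exact hF.varsB K hK l hl

theorem mem_matrix {s : Bool} {K : List Lit} (hK : K ∈ F.sideCNF s) : K ∈ F.matrix := by
  cases s
  · exact List.mem_append_left _ hK
  · exact List.mem_append_right _ hK

end Instance

/-- The interpretation of the lines of `S`-proofs of `F` that drives interpolation: the literals
over `p` of a line are read off by `lits`, and `Holds s α C` says that, under the assignment `α` to
`p`, the remaining part of `C` is a sound consequence of `A` (`s = false`) or `B` (`s = true`)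
alone. -/
structure Reading {Λ : Type} (S : Calculus Λ) (F : Instance) where
  lits : List Λ → Set Lit
  Inv : List Λ → Prop
  Holds : Bool → (ℕ → Bool) → List Λ → Prop
  leaf_inv : ∀ {K C}, K ∈ F.matrix → S.leafRule F.pre K C → Inv C
  leaf_lits : ∀ {K C}, S.leafRule F.pre K C → ∀ l ∈ K, l.1 ∈ F.p → l ∈ lits C
  leaf : ∀ {s α K C}, K ∈ F.sideCNF s → S.leafRule F.pre K C →
    (∀ l ∈ K, l.1 ∈ F.p → α l.1 ≠ l.2) → Holds s α C
  unary_inv : ∀ {C D}, Inv C → S.unaryRule F.pre C D → Inv D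
  unary_lits : ∀ {C D}, S.unaryRule F.pre C D → ∀ l ∈ lits C, l.1 ∈ F.p → l ∈ lits D
  unary : ∀ {s α C D}, Inv C → S.unaryRule F.pre C D → Holds s α C → Holds s α D
  res_inv : ∀ {x C D E}, Inv C → Inv D → S.resRule F.pre x C D E → Inv E
  left_lits : ∀ {x C D E}, Inv C → Inv D → S.resRule F.pre x C D E →
    ∀ l ∈ lits C, l.1 ∈ F.p → l ≠ (x, true) → l ∈ lits E
  right_lits : ∀ {x C D E}, Inv C → Inv D → S.resRule F.pre x C D E →
    ∀ l ∈ lits D, l.1 ∈ F.p → l ≠ (x, false) → l ∈ lits E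
  left : ∀ {s α x C D E}, Inv C → Inv D → S.resRule F.pre x C D E →
    x ∉ (F.sidePrefix s).map Prod.snd → Holds s α C → Holds s α E
  right : ∀ {s α x C D E}, Inv C → Inv D → S.resRule F.pre x C D E →
    x ∉ (F.sidePrefix s).map Prod.snd → Holds s α D → Holds s α E
  res : ∀ {s α x C D E}, Inv C → Inv D → S.resRule F.pre x C D E →
    Holds s α C → Holds s α D → Holds s α E
  nil : ∀ {s α}, Holds s α [] → ¬ QTrue (F.sidePrefix s) (F.sideCNF s) α
  nil_lits : lits [] = ∅

/-- The value `val i` of the gate of line `i` fits the origin of the line. In the monotone version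
the selector gates are replaced. -/
def GateSpec (F : Instance) (mono : Bool) (α val : ℕ → Bool) (i : ℕ) : Source → Prop
  | Source.leaf k => val i = decide (F.A.length ≤ k)
  | Source.unary j => val i = val j
  | Source.res j k x =>
      if x ∈ F.p then
        val i = if mono then (α x || val j) && val k else if α x then val k else val j
      else if x ∈ F.q.map Prod.snd then val i = (val j || val k)
      else val i = (val j && val k)

/-- Gate values along an `S`-refutation of `F` interpolate. -/
def Interpolates {Λ : Type} (S : Calculus Λ) : Prop :=
  ∀ (F : Instance) (π : ProofGraph Λ), F.WellFormed → S.Refutes F.pre F.matrix π →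
    ∀ (mono : Bool) (α val : ℕ → Bool), (mono = true → F.PositiveInA) →
      (∀ i C s, π[i]? = some (C, s) → GateSpec F mono α val i s) →
      ∀ s, val (π.length - 1) = s → ¬ QTrue (F.sidePrefix s) (F.sideCNF s) α

/-! ### The invariant of lines and gates -/

section

variable {Λ : Type} {S : Calculus Λ} {F : Instance}

/-- No relevant literal over `p` is true: for the monotone version, the negative ones do not matter
on the side of `A`. -/
def Falsified (F : Instance) (mono : Bool) (α : ℕ → Bool) (s : Bool) (L : Set Lit) : Prop :=
  ∀ l ∈ L, l.1 ∈ F.p → l.2 = true ∨ mono = false ∨ s = true → α l.1 ≠ l.2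

/-- The heart of interpolation, by strong induction on the line. The gate of a resolution step
always picks a side on which either one premise suffices or both premises are available. The
selector and the monotone version are treated together, since they differ only in which literals
must be falsified. -/
theorem Reading.holds (R : Reading S F) (hF : F.WellFormed) {π : ProofGraph Λ}
    (hπ : ∀ i C s, π[i]? = some (C, s) → S.StepOK F.pre F.matrix π i C s)
    {mono : Bool} {α val : ℕ → Bool} (hmono : mono = true → F.PositiveInA)
    (hval : ∀ i C s, π[i]? = some (C, s) → GateSpec F mono α val i s) (i : ℕ) :
    ∀ C s, π[i]? = some (C, s) →
      R.Inv C ∧ (Falsified F mono α (val i) (R.lits C) → R.Holds (val i) α C) := by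
  induction i using Nat.strong_induction_on with
  | _ i ih =>
  intro E s hi
  have hs := hπ i E s hi
  have hg := hval i E s hi
  cases s with
  | leaf k =>
    obtain ⟨K, hK, hleaf⟩ := hs
    have hg : val i = decide (F.A.length ≤ k) := hg
    have hside : K ∈ F.sideCNF (val i) := by
      by_cases hk : F.A.length ≤ k
      · rw [hg, decide_eq_true hk]
        rw [Instance.matrix, List.getElem?_append_right hk] at hK
        exact List.mem_of_getElem? hK
      · rw [hg, decide_eq_false hk]
        rw [Instance.matrix, List.getElem?_append_left (not_le.1 hk)] at hK
        exact List.mem_of_getElem? hK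
    refine ⟨R.leaf_inv (Instance.mem_matrix hside) hleaf, fun hE => ?_⟩
    refine R.leaf hside hleaf fun l hl hlp => hE l (R.leaf_lits hleaf l hl hlp) hlp ?_
    cases hm : mono
    · exact Or.inr (Or.inl rfl)
    · cases hv : val i
      -- Clauses of `A` have only positive literals over `p` here, so exempting negative ones on
      -- side `A` loses nothing.
      · left
        rw [hv] at hside
        by_contra hl2
        refine hmono hm K hside l.1 hlp ?_
        rwa [← Bool.eq_false_iff.2 hl2]
      · exact Or.inr (Or.inr rfl)
  | unary j =>
    obtain ⟨hj, C, ⟨s, hC⟩, hrule⟩ := hs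
    have hg : val i = val j := hg
    obtain ⟨hinv, hh⟩ := ih j hj C s hC
    refine ⟨R.unary_inv hinv hrule, fun hE => ?_⟩
    rw [hg] at hE ⊢
    exact R.unary hinv hrule
      (hh fun l hl hlp => hE l (R.unary_lits hrule l hl hlp) hlp)
  | res j k x =>
    obtain ⟨hj, hk, C, D, ⟨s, hC⟩, ⟨t, hD⟩, hrule⟩ := hs
    obtain ⟨invC, hhC⟩ := ih j hj C s hC
    obtain ⟨invD, hhD⟩ := ih k hk D t hD
    refine ⟨R.res_inv invC invD hrule, fun hE => ?_⟩
    -- Apart from the pivot, the literals of a premise over `p` recur in the conclusion and are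
    -- falsified with it.
    have falsC : (x ∈ F.p → α x ≠ true) → val j = val i → R.Holds (val i) α C := by
      intro hx hv
      rw [← hv]
      refine hhC fun l hl hlp h => ?_
      by_cases hlx : l = (x, true)
      · subst hlx
        exact hx hlp
      · exact hE l (R.left_lits invC invD hrule l hl hlp hlx) hlp (hv ▸ h)
    have falsD : (x ∈ F.p → mono = false ∨ val i = true → α x ≠ false) → val k = val i →
        R.Holds (val i) α D := by
      intro hx hv
      rw [← hv]
      refine hhD fun l hl hlp h => ?_
      by_cases hlx : l = (x, false)
      · subst hlx
        exact hx hlp ((h.resolve_left Bool.false_ne_true).imp id fun h => hv ▸ h)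
      · exact hE l (R.right_lits invC invD hrule l hl hlp hlx) hlp (hv ▸ h)
    by_cases hxp : x ∈ F.p
    · have hg : val i = if mono then (α x || val j) && val k else if α x then val k else val j := by
        simpa only [GateSpec, if_pos hxp] using hg
      have hxs := hF.notMem_side hxp (val i)
      have fromC : α x = false → val j = val i → R.Holds (val i) α E := fun ha hv =>
        R.left invC invD hrule hxs (falsC (fun _ => by simp [ha]) hv)
      have fromD : (mono = false ∨ val i = true → α x ≠ false) → val k = val i →
          R.Holds (val i) α E := fun ha hv =>
        R.right invC invD hrule hxs (falsD (fun _ => ha) hv)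
      cases ha : α x
      · cases hm : mono
        · exact fromC ha (by simp [hg, hm, ha])
        -- Here the monotone gate may deviate from the selector: if `val k` is `false`, it answers
        -- `A` whatever `val j` is. The premise with `¬ x` is then used although this literal is
        -- true, which is allowed on side `A`.
        · cases hvk : val k
          · have hvi : val i = false := by simp [hg, hm, hvk]
            exact fromD (fun h => by simp [hm, hvi] at h) (hvk.trans hvi.symm)
          · exact fromC ha (by simp [hg, hm, ha, hvk])
      · exact fromD (fun _ => by simp [ha]) (by cases hm : mono <;> simp [hg, hm, ha])
    -- A pivot in `q` is invisible on side `B`, so a single premise of value `true` decides; every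
    -- other pivot outside `p` is invisible on side `A`, where a single premise of value `false`
    -- decides.
    by_cases hxq : x ∈ F.q.map Prod.snd
    · have hg : val i = (val j || val k) := by
        simpa only [GateSpec, if_neg hxp, if_pos hxq] using hg
      cases hvj : val j
      · have hvk : val k = val i := by simp [hg, hvj]
        have hDh := falsD (fun h => absurd h hxp) hvk
        cases hvi : val i
        · exact hvi ▸ R.res invC invD hrule
            (falsC (fun h => absurd h hxp) (hvj.trans hvi.symm)) hDh
        · rw [hvi] at hDh
          exact R.right invC invD hrule (hF.notMem_r hxq) hDh
      · have hvi : val i = true := by simp [hg, hvj]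
        have hCh := falsC (fun h => absurd h hxp) (hvj.trans hvi.symm)
        rw [hvi] at hCh ⊢
        exact R.left invC invD hrule (hF.notMem_r hxq) hCh
    · have hg : val i = (val j && val k) := by
        simpa only [GateSpec, if_neg hxp, if_neg hxq] using hg
      cases hvj : val j
      · have hvi : val i = false := by simp [hg, hvj]
        have hCh := falsC (fun h => absurd h hxp) (hvj.trans hvi.symm)
        rw [hvi] at hCh ⊢
        exact R.left invC invD hrule hxq hCh
      · have hvk : val k = val i := by simp [hg, hvj]
        have hDh := falsD (fun h => absurd h hxp) hvk
        cases hvi : val i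
        · rw [hvi] at hDh
          exact R.right invC invD hrule hxq hDh
        · exact hvi ▸ R.res invC invD hrule
            (falsC (fun h => absurd h hxp) (hvj.trans hvi.symm)) hDh

theorem Interpolates.of_reading (R : ∀ F : Instance, F.WellFormed → Nonempty (Reading S F)) :
    Interpolates S := by
  intro F π hF hπ mono α val hmono hval s hs
  obtain ⟨R⟩ := R F hF
  obtain ⟨t, ht⟩ := hπ.2.1
  rw [List.getLast?_eq_getElem?] at ht
  have h := (R.holds hF hπ.1 hmono hval _ _ _ ht).2 fun l hl => by simp [R.nil_lits] at hl
  rw [hs] at h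
  exact R.nil h

/-- Refutations of `S` are refutations of `T` if, on lines that satisfy an invariant of `S`, every
rule of `S` is a rule of `T`. -/
theorem Interpolates.of_le {T : Calculus Λ} (hT : Interpolates T) (Inv : List Λ → Prop)
    (shape : ∀ π, S.shape π → T.shape π)
    (leaf : ∀ {Q K C}, S.leafRule Q K C → T.leafRule Q K C ∧ Inv C)
    (unary : ∀ {Q C D}, Inv C → S.unaryRule Q C D → T.unaryRule Q C D ∧ Inv D)
    (res : ∀ {Q x C D E}, Inv C → Inv D → S.resRule Q x C D E → T.resRule Q x C D E ∧ Inv E) :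
    Interpolates S := by
  intro F π hF hπ
  refine hT F π hF ⟨?_, hπ.2.1, shape _ hπ.2.2⟩
  suffices h : ∀ i C s, π[i]? = some (C, s) → T.StepOK F.pre F.matrix π i C s ∧ Inv C from
    fun i C s hi => (h i C s hi).1
  intro i
  induction i using Nat.strong_induction_on with
  | _ i ih =>
  intro E s hi
  have hs := hπ.1 i E s hi
  cases s with
  | leaf k =>
    obtain ⟨K, hK, h⟩ := hs
    exact ⟨⟨K, hK, (leaf h).1⟩, (leaf h).2⟩
  | unary j =>
    obtain ⟨hj, C, ⟨s, hC⟩, h⟩ := hs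
    have h' := unary (ih j hj C s hC).2 h
    exact ⟨⟨hj, C, ⟨s, hC⟩, h'.1⟩, h'.2⟩
  | res j k x =>
    obtain ⟨hj, hk, C, D, ⟨s, hC⟩, ⟨t, hD⟩, h⟩ := hs
    have h' := res (ih j hj C s hC).2 (ih k hk D t hD).2 h
    exact ⟨⟨hj, hk, C, D, ⟨s, hC⟩, ⟨t, hD⟩, h'.1⟩, h'.2⟩

end

/-! ### The CDCL-based calculi interpolate -/

namespace CDCL

theorem Leaf.consistent {Q : Prefix} {K : List Lit} {C : List MLit}
    (hK : ∀ x : ℕ, ¬ ((x, true) ∈ K ∧ (x, false) ∈ K)) (h : Leaf Q K C) :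
    Consistent (litSet C) := by
  rw [show litSet C = _ from h]
  rintro _ ⟨⟨x, b⟩, hl, rfl⟩ _ ⟨⟨y, c⟩, hk, rfl⟩ (rfl : x = y)
  cases b <;> cases c
  · rfl
  · exact absurd ⟨hk, hl⟩ (hK x)
  · exact absurd ⟨hl, hk⟩ (hK x)
  · rfl

/-- Both kinds of universal reduction remove a universal literal to the right of the existential
literals. -/
theorem exists_reduced {Q : Prefix} {C D : Set MLit} (h : URed Q C D ∨ URedStar Q C D) :
    ∃ l ∈ C, IsAll Q l.1 ∧ D = C \ {l} ∧ ∀ k ∈ D, IsEx Q k.1 → idx Q k.1 ≤ idx Q l.1 := by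
  obtain ⟨l, hl, -, h⟩ | ⟨l, hl, -, h⟩ := h <;> exact ⟨l, hl, h⟩

/-- The reading of LQU⁺-Res. -/
def reading (F : Instance) (hF : F.WellFormed) : Reading lquPlusRes F where
  lits C := {l | Lit.toMLit l ∈ litSet C}
  Inv C := Consistent (litSet C)
  Holds s α C := Entails (F.sideCNF s) (F.sidePrefix s) α (litSet C)
  leaf_inv hK h := Leaf.consistent (Q := F.pre) (hF.nontaut _ hK) h
  leaf_lits {K C} h l hl _ := by
    show Lit.toMLit l ∈ litSet C
    rw [show litSet C = _ from h]
    exact ⟨l, hl, rfl⟩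
  leaf {s α K C} hK h hα := by
    refine Entails.of_mem hK (hF.sortedBy s) fun l hl => ?_
    split
    · rw [show litSet C = _ from h]
      exact ⟨l, hl, rfl⟩
    · rename_i hlQ
      exact hα l hl ((hF.vars_side hK hl).resolve_right hlQ)
  unary_inv {C D} hC h := by
    obtain ⟨l, -, -, hD, -⟩ := exists_reduced h
    exact hC.mono (hD ▸ Set.sdiff_subset)
  unary_lits {C D} h k hk hkp := by
    obtain ⟨l, -, hl, hD, -⟩ := exists_reduced h
    show Lit.toMLit k ∈ litSet D
    rw [hD]
    refine ⟨hk, ?_⟩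
    rintro rfl
    exact hF.not_isAll_of_mem_p hkp hl
  unary {s α C D} hC h hα := by
    obtain ⟨l, hl, hall, hD, hidx⟩ := exists_reduced h
    show Entails _ _ _ (litSet D)
    rw [hD] at hidx ⊢
    -- The reduced variable may belong to the other side; all that matters is that it is not
    -- existential on this one.
    exact hα.reduce (hF.sortedBy s) hC hl
      (fun he => hF.sortedBy_pre.not_isAll_of_isEx (Instance.isEx_pre he) hall)
      fun k hk hkQ => hidx k hk (Instance.isEx_pre hkQ)
  res_inv hC hD h := (h.2.resolvesTo hC hD).2
  left_lits hC hD h l hl hlp hne := by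
    refine ((h.2.resolvesTo hC hD).1.left _ hl ?_).resolve_right fun h1 =>
      hF.not_isAll_of_mem_p hlp h1.1
    rcases l with ⟨y, _ | _⟩
    · simp [Lit.toMLit]
    · simpa [Lit.toMLit] using hne
  right_lits hC hD h l hl hlp hne := by
    refine ((h.2.resolvesTo hC hD).1.right _ hl ?_).resolve_right fun h1 =>
      hF.not_isAll_of_mem_p hlp h1.1
    rcases l with ⟨y, _ | _⟩
    · simpa [Lit.toMLit] using hne
    · simp [Lit.toMLit]
  left {s _ _ _ _ _} hC hD h hx hα := (h.2.resolvesTo hC hD).1.lift_left (hF.sortedBy s)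
    (fun _ => hF.isAll_side) hC hx hα
  right {s _ _ _ _ _} hC hD h hx hα := (h.2.resolvesTo hC hD).1.lift_right (hF.sortedBy s)
    (fun _ => hF.isAll_side) hD hx hα
  res {s _ _ _ _ _} hC hD h h1 h2 := (h.2.resolvesTo hC hD).1.entails (hF.sortedBy s)
    (fun _ => hF.isAll_side) hC hD h1 h2
  nil h := by
    refine Entails.not_qTrue ?_
    simpa [litSet] using h
  nil_lits := by simp [litSet]

end CDCL

theorem interpolates_lquPlusRes : Interpolates lquPlusRes :=
  .of_reading fun F hF => ⟨CDCL.reading F hF⟩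

theorem interpolates_ldQRes : Interpolates ldQRes :=
  interpolates_lquPlusRes.of_le (fun _ => True) (fun _ h => h) (fun h => ⟨h, trivial⟩)
    (fun _ h => ⟨h, trivial⟩) fun _ _ h => ⟨⟨Or.inl h.1, h.2⟩, trivial⟩

/-- No rule of this calculus creates merged literals, and on clauses without them short resolution
is a special case of long-distance resolution. -/
theorem interpolates_quRes : Interpolates quRes := by
  refine interpolates_lquPlusRes.of_le (fun C => ∀ l ∈ litSet C, l.2 ≠ Sign.star) (fun _ h => h)
    (fun {Q K C} h => ⟨h, ?_⟩) (fun {Q C D} hC h => ⟨Or.inl h, ?_⟩)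
    (fun {Q x C D E} hC hD h => ⟨⟨h.1, h.2.lRes hC hD⟩, ?_⟩)
  · rw [show litSet C = _ from h]
    rintro _ ⟨l, -, rfl⟩
    exact CDCL.toMLit_ne_star l
  · obtain ⟨l, -, -, -, hD, -⟩ := h
    rw [hD]
    exact fun k hk => hC k hk.1
  · obtain ⟨-, C₁, C₂, -, h1, -, h2, -, hE⟩ := h
    rw [hE]
    rintro l (hl | hl)
    · exact hC l (h1 ▸ Or.inl hl)
    · exact hD l (h2 ▸ Or.inl hl)

theorem interpolates_qRes : Interpolates qRes :=
  interpolates_quRes.of_le (fun _ => True) (fun _ h => h) (fun h => ⟨h, trivial⟩)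
    (fun _ h => ⟨h, trivial⟩) fun _ _ h => ⟨⟨Or.inl h.1, h.2⟩, trivial⟩

theorem interpolates_treeQRes : Interpolates treeQRes :=
  interpolates_qRes.of_le (fun _ => True) (fun _ _ => trivial) (fun h => ⟨h, trivial⟩)
    (fun _ h => ⟨h, trivial⟩) fun _ _ h => ⟨h, trivial⟩

/-! ### The expansion-based calculi interpolate -/

namespace Expansion

/-- Every literal of `C` has a counterpart in `D` after instantiation by `τ` and merging. -/
def Reaches (Q : Prefix) (τ : Ann) (C D : Set (Lit × Ann)) : Prop :=
  ∀ l ∈ C, ∃ σ, (l.1, σ) ∈ D ∧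
    ∀ u, IsAll Q u → idx Q u < idx Q l.1.1 → Coarsens ((l.2 u).or (τ u)) (σ u)

/-- The common generalization of the expansion-based calculi. -/
def calculus : Calculus ALit where
  leafRule Q K C := ∃ τ : Ann, τ.Binary ∧
    (∀ l ∈ K, IsAll Q l.1 → τ l.1 = some (boolVal !l.2)) ∧ denote C = annotate Q τ K
  unaryRule Q C D := ∃ τ : Ann, Reaches Q τ (denote C) (denote D)
  resRule Q x C D E := ∃ τ ξ σ : Ann, τ.Binary ∧ Disjoint ξ.dom σ.dom ∧
    Reaches Q σ (denote C \ {((x, true), Ann.complete τ ξ)}) (denote E) ∧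
    Reaches Q ξ (denote D \ {((x, false), Ann.complete τ σ)}) (denote E)
  shape _ := True

variable {Q : Prefix} {τ : Ann} {C D E : Set (Lit × Ann)} {F : Instance}

theorem Reaches.embeds (h : Reaches F.pre τ C D) (s : Bool) :
    Embeds (idx F.pre) (F.sidePrefix s) τ C D :=
  fun l hl _ => (h l hl).imp fun _ h => ⟨h.1, fun u hu => h.2 u (Instance.isAll_pre hu)⟩

theorem Reaches.of_inst (h : inst Q τ C ⊆ D) : Reaches Q τ C D := by
  intro l hl
  refine ⟨_, h ⟨l, hl, rfl⟩, fun u hu hidx => Or.inl ?_⟩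
  simp [Ann.permitted, hu, hidx, Ann.complete]

theorem Reaches.of_subset (h : C ⊆ D) : Reaches Q (fun _ => none) C D := by
  intro l hl
  exact ⟨l.2, h hl, fun u _ _ => Or.inl (Option.or_none).symm⟩

/-- Where the two annotations differ, both are defined because their domains agree. So the merge
only coarsens values to `*` and never marks an unmarked variable. -/
theorem Merging.reaches (h : Merging C D) : Reaches Q (fun _ => none) C D := by
  obtain ⟨b, μ, σ, -, -, hdom, rfl⟩ := h
  have hne : ∀ u, μ u = none ↔ σ u = none := fun u =>
    not_iff_not.1 (show u ∈ μ.dom ↔ u ∈ σ.dom from hdom ▸ Iff.rfl)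
  intro l hl
  by_cases h1 : l = (b, μ)
  · subst h1
    refine ⟨_, Or.inr rfl, fun u _ _ => ?_⟩
    rw [Option.or_none]
    by_cases he : μ u = σ u
    · exact Or.inl (if_pos he)
    · exact Or.inr ⟨fun h => he (h.trans ((hne u).1 h).symm), if_neg he⟩
  by_cases h2 : l = (b, σ)
  · subst h2
    refine ⟨_, Or.inr rfl, fun u _ _ => ?_⟩
    rw [Option.or_none]
    by_cases he : μ u = σ u
    · exact Or.inl ((if_pos he).trans he)
    · exact Or.inr ⟨fun h => he (((hne u).2 h).trans h.symm), if_neg he⟩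
  · exact ⟨l.2, Or.inl ⟨hl, by rintro (h | h); exacts [h1 h, h2 h]⟩,
      fun u _ _ => Or.inl (Option.or_none).symm⟩

/-- The reading of the expansion-based calculi. -/
def reading (F : Instance) (hF : F.WellFormed) : Reading calculus F where
  lits C := {l | ∃ σ, (l, σ) ∈ denote C}
  Inv _ := True
  Holds s α C := Entails (F.sideCNF s) (F.sidePrefix s) α (denote C)
  leaf_inv _ _ := trivial
  leaf_lits {K C} h l hl hlp := by
    obtain ⟨τ, -, -, hC⟩ := h
    refine ⟨Ann.permitted F.pre l.1 τ, ?_⟩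
    rw [hC]
    exact ⟨l, ⟨hl, Instance.WellFormed.isEx_of_mem_p hlp⟩, rfl⟩
  leaf {s α K C} hK h hα := by
    obtain ⟨τ, hτ, hall, hC⟩ := h
    refine Entails.of_mem hK (hF.sortedBy s) hτ (fun l hl hlQ => ?_)
      (fun l hl hlQ => hall l hl (Instance.isAll_pre hlQ))
      fun l hl hlQ => hα l hl ((hF.vars_side hK hl).resolve_right hlQ)
    refine ⟨_, by rw [hC]; exact ⟨l, ⟨hl, Instance.isEx_pre hlQ⟩, rfl⟩, fun u hu hidx => ?_⟩
    simp [Ann.permitted, Instance.isAll_pre hu, hidx]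
  unary_inv _ _ := trivial
  unary_lits h l hl _ := by
    obtain ⟨τ, h⟩ := h
    obtain ⟨σ, hσ⟩ := hl
    exact (h _ hσ).imp fun _ h => h.1
  unary {s _ _ _} _ h hα := by
    obtain ⟨τ, h⟩ := h
    exact hα.lift (hF.sortedBy s) (h.embeds s)
  res_inv _ _ _ := trivial
  left_lits _ _ h l hl _ hne := by
    obtain ⟨τ, ξ, σ, -, -, hC, -⟩ := h
    obtain ⟨ρ, hρ⟩ := hl
    exact (hC _ ⟨hρ, fun he => hne (congrArg Prod.fst he)⟩).imp fun _ h => h.1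
  right_lits _ _ h l hl _ hne := by
    obtain ⟨τ, ξ, σ, -, -, -, hD⟩ := h
    obtain ⟨ρ, hρ⟩ := hl
    exact (hD _ ⟨hρ, fun he => hne (congrArg Prod.fst he)⟩).imp fun _ h => h.1
  left {s _ _ _ _ _} _ _ h hx hα := by
    obtain ⟨τ, ξ, σ, -, -, hC, -⟩ := h
    refine hα.lift (hF.sortedBy s) (τ := σ) fun l hl hlQ => hC.embeds s l ⟨hl, ?_⟩ hlQ
    rintro rfl
    exact hx hlQ.mem
  right {s _ _ _ _ _} _ _ h hx hα := by
    obtain ⟨τ, ξ, σ, -, -, -, hD⟩ := h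
    refine hα.lift (hF.sortedBy s) (τ := ξ) fun l hl hlQ => hD.embeds s l ⟨hl, ?_⟩ hlQ
    rintro rfl
    exact hx hlQ.mem
  res {s _ _ _ _ _} _ _ h h1 h2 := by
    obtain ⟨τ, ξ, σ, hτ, hξσ, hC, hD⟩ := h
    exact h1.resolve (hF.sortedBy s) hτ hξσ (hC.embeds s) (hD.embeds s) h2
  nil h := by
    refine Entails.not_qTrue ?_
    simpa [denote, litSet] using h
  nil_lits := by simp [denote, litSet]

/-! ### The concrete annotated calculi as cases of the common one -/

theorem falsifier.binary {K : List Lit} (h : falsifier Q K τ) : τ.Binary := fun u => (h u).2.2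

theorem Leaf.general {K : List Lit} {C : List ALit} (h : Leaf Q K C) :
    calculus.leafRule Q K C := by
  obtain ⟨τ, hτ, hC⟩ := h
  refine ⟨τ, hτ.binary, ?_, hC⟩
  rintro ⟨u, _ | _⟩ hl hu
  · exact (hτ u).2.1.2 ⟨hu, hl⟩
  · exact (hτ u).1.2 ⟨hu, hl⟩

theorem LeafComplete.general {K : List Lit} {C : List ALit} (h : LeafComplete Q K C) :
    calculus.leafRule Q K C := by
  obtain ⟨τ, hτ, -, h0, h1, hC⟩ := h
  refine ⟨τ, hτ, ?_, hC⟩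
  rintro ⟨u, _ | _⟩ hl hu
  · exact h1 u hu hl
  · exact h0 u hu hl

/-- All annotations in `C` have values in `{0, 1}`. -/
def BinaryClause (C : Set (Lit × Ann)) : Prop := ∀ l ∈ C, l.2.Binary

theorem binary_permitted {x : ℕ} (hτ : τ.Binary) : (Ann.permitted Q x τ).Binary := by
  intro u
  unfold Ann.permitted
  split
  · exact hτ u
  · simp

theorem binaryClause_of_leaf {K : List Lit} {C : List ALit} (h : calculus.leafRule Q K C) :
    BinaryClause (denote C) := by
  obtain ⟨τ, hτ, -, hC⟩ := h
  rw [hC]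
  rintro _ ⟨l, -, rfl⟩
  exact binary_permitted hτ

theorem Instantiation.binaryClause (h : Instantiation Q C D) (hC : BinaryClause C) :
    BinaryClause D := by
  obtain ⟨τ, hτ, -, rfl⟩ := h
  rintro _ ⟨l, hl, rfl⟩
  refine binary_permitted fun u hu => ?_
  rcases Option.or_eq_some_iff.1 hu with h | ⟨-, h⟩
  · exact hC l hl u h
  · exact hτ u h

theorem Res.binaryClause {x : ℕ} (h : Res x C D E) (hC : BinaryClause C) (hD : BinaryClause D) :
    BinaryClause E := by
  obtain ⟨τ, -, -, rfl⟩ := h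
  rintro l (hl | hl)
  · exact hC l hl.1
  · exact hD l hl.1

/-- The case of empty `ξ` and `σ`. Then `τ` is the whole pivot annotation, which is why annotations
must be known to stay free of `*` along the proof. -/
theorem Res.general {x : ℕ} {C D E : List ALit} (h : Res x (denote C) (denote D) (denote E))
    (hC : BinaryClause (denote C)) : calculus.resRule Q x C D E := by
  obtain ⟨τ, h1, -, hE⟩ := h
  have hτ : Ann.complete τ (fun _ => none) = τ := funext fun u => Option.or_none
  refine ⟨τ, fun _ => none, fun _ => none, hC _ h1, by simp [Ann.dom], ?_, ?_⟩ <;> rw [hτ, hE]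
  · exact .of_subset Set.subset_union_left
  · exact .of_subset Set.subset_union_right

end Expansion

theorem Expansion.interpolates : Interpolates Expansion.calculus :=
  .of_reading fun F hF => ⟨Expansion.reading F hF⟩

theorem interpolates_irmCalc : Interpolates irmCalc := by
  refine Expansion.interpolates.of_le (fun _ => True) (fun _ h => h)
    (fun h => ⟨Expansion.Leaf.general h, trivial⟩) (fun _ h => ⟨?_, trivial⟩)
    fun _ _ h => ⟨?_, trivial⟩
  · obtain ⟨τ, -, -, hD⟩ | h := h
    · exact ⟨τ, .of_inst hD.ge⟩
    · exact ⟨_, h.reaches⟩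
  · obtain ⟨τ, ξ, σ, -, -, hξσ, hτ, -, -, hE⟩ := h
    exact ⟨τ, ξ, σ, hτ, hξσ, .of_inst (hE ▸ Set.subset_union_left),
      .of_inst (hE ▸ Set.subset_union_right)⟩

theorem interpolates_irCalc : Interpolates irCalc := by
  refine Expansion.interpolates.of_le (fun C => Expansion.BinaryClause (denote C)) (fun _ h => h)
    (fun h => ⟨Expansion.Leaf.general h, Expansion.binaryClause_of_leaf (Expansion.Leaf.general h)⟩)
    (fun hC h => ⟨?_, h.binaryClause hC⟩) fun hC hD h => ⟨h.general hC, h.binaryClause hC hD⟩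
  obtain ⟨τ, -, -, hD⟩ := h
  exact ⟨τ, .of_inst hD.ge⟩

theorem interpolates_forallExpRes : Interpolates forallExpRes :=
  Expansion.interpolates.of_le (fun C => Expansion.BinaryClause (denote C)) (fun _ h => h)
    (fun h => ⟨Expansion.LeafComplete.general h,
      Expansion.binaryClause_of_leaf (Expansion.LeafComplete.general h)⟩)
    (fun _ h => h.elim) fun hC hD h => ⟨h.general hC, h.binaryClause hC hD⟩

/-! ### Evaluation of circuits -/

theorem Gate.eval_congr {α : ℕ → Bool} {vs ws : List Bool} {g : Gate}
    (h : ∀ j ∈ g.args, vs.getD j false = ws.getD j false) : g.eval α vs = g.eval α ws := by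
  cases g <;> simp only [Gate.args, List.mem_cons, List.not_mem_nil, or_false, forall_eq_or_imp,
    forall_eq] at h <;> simp only [Gate.eval, h]

namespace Circuit

theorem values_concat (α : ℕ → Bool) (G : Circuit) (g : Gate) :
    values α (G ++ [g]) = values α G ++ [g.eval α (values α G)] := by
  simp [values, List.foldl_append]

theorem length_values (α : ℕ → Bool) (G : Circuit) : (values α G).length = G.length := by
  induction G using List.reverseRecOn with
  | nil => rfl
  | append_singleton G g ih => simp [values_concat, ih]

/-- A gate reads earlier positions only, and later gates do not alter their values. So its equation
also holds for the final list of values, which is the form that the gate specification needs. -/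
theorem getD_values {G : Circuit} (hG : ∀ i g, G[i]? = some g → ∀ j ∈ Gate.args g, j < i)
    (α : ℕ → Bool) {i : ℕ} {g : Gate} (hi : G[i]? = some g) :
    (values α G).getD i false = g.eval α (values α G) := by
  induction G using List.reverseRecOn generalizing i g with
  | nil => simp at hi
  | append_singleton G g₀ ih =>
    have hlt : ∀ j, j < G.length →
        (values α (G ++ [g₀])).getD j false = (values α G).getD j false := fun j hj => by
      rw [values_concat, List.getD_append _ _ _ _ (by rwa [length_values])]
    have harg : ∀ j ∈ g.args, j < i := hG i g hi
    have hlen : i < G.length + 1 := by simpa using (List.getElem?_eq_some_iff.1 hi).1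
    have heval : g.eval α (values α (G ++ [g₀])) = g.eval α (values α G) :=
      Gate.eval_congr fun j hj => hlt j (by have := harg j hj; omega)
    rw [heval]
    by_cases hiG : i < G.length
    · rw [List.getElem?_append_left hiG] at hi
      rw [hlt i hiG]
      refine ih (fun i g h => hG i g ?_) hi
      rw [List.getElem?_append_left (List.getElem?_eq_some_iff.1 h).1, h]
    · obtain rfl : i = G.length := by omega
      obtain rfl : g₀ = g := by simpa using hi
      rw [values_concat, List.getD_append_right _ _ _ _ (by rw [length_values])]
      simp [length_values]

theorem eval_eq_getD (G : Circuit) (α : ℕ → Bool) :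
    G.eval α = (values α G).getD (G.length - 1) false := by
  rw [eval, List.getLastD_eq_getLast?, List.getLast?_eq_getElem?, length_values,
    List.getD_eq_getElem?_getD]

end Circuit

/-! ### The selector circuit of a proof -/

/-- The gate of a line in the selector circuit. -/
def selGate (F : Instance) : Source → Gate
  | Source.leaf k => Gate.const (decide (F.A.length ≤ k))
  -- The basis has no copy gate.
  | Source.unary j => Gate.and j j
  | Source.res j k x =>
      if x ∈ F.p then Gate.sel x j k
      else if x ∈ F.q.map Prod.snd then Gate.or j k
      else Gate.and j k

/-- One gate for each line of the proof. -/
def selCircuit {Λ : Type} (t : Instance × ProofGraph Λ) : Circuit :=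
  t.2.map fun l => selGate t.1 l.2

/-- Gate `r` of a block at position `b` that computes `sel x g h` over the usual basis. -/
def selBlock (x b g h : ℕ) : ℕ → Gate
  | 0 => Gate.input x
  | 1 => Gate.not b
  | 2 => Gate.and (b + 1) g
  | 3 => Gate.and b h
  | _ => Gate.or (b + 2) (b + 3)

/-- Gate `r` of a block at position `b` that computes `(x ∨ g) ∧ h`. -/
def orAndBlock (x b g h : ℕ) : ℕ → Gate
  | 0 => Gate.input x
  | 1 => Gate.or b g
  -- Three gates suffice; the last is repeated so that every block has its output at offset 4.
  | _ => Gate.and (b + 1) h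

/-- The gate at position `b + r` in the block at position `b`, `r < 5`, of the circuit over the
usual basis. The value of a line is the value of the last gate of its block. -/
def stdGate (F : Instance) (pos : Bool) (b r : ℕ) : Source → Gate
  | Source.leaf k => Gate.const (decide (F.A.length ≤ k))
  | Source.unary j => Gate.and (5 * j + 4) (5 * j + 4)
  | Source.res j k x =>
      if x ∈ F.p then
        if pos then orAndBlock x b (5 * j + 4) (5 * k + 4) r
        else selBlock x b (5 * j + 4) (5 * k + 4) r
      else if x ∈ F.q.map Prod.snd then Gate.or (5 * j + 4) (5 * k + 4)
      else Gate.and (5 * j + 4) (5 * k + 4)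

open Classical in
/-- Five gates for each line of the proof. -/
noncomputable def stdCircuit {Λ : Type} (t : Instance × ProofGraph Λ) : Circuit :=
  (List.range (5 * t.2.length)).map fun m =>
    stdGate t.1 (decide t.1.PositiveInA) (5 * (m / 5)) (m % 5)
      -- The default is never used, since `m / 5` is less than the number of lines.
      ((t.2[m / 5]?.map Prod.snd).getD (Source.leaf 0))

/-! ### Correctness of the two circuits -/

section

variable {Λ : Type} {S : Calculus Λ} {F : Instance} {π : ProofGraph Λ}

theorem Calculus.Refutes.premises_lt (h : S.Refutes F.pre F.matrix π) {i : ℕ} {C : List Λ}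
    {s : Source} (hi : π[i]? = some (C, s)) : ∀ j ∈ s.premises, j < i := by
  have := h.1 i C s hi
  cases s with
  | leaf k => simp [Source.premises]
  | unary j => simpa [Source.premises] using this.1
  | res j k x => simpa [Source.premises] using ⟨this.1, this.2.1⟩

theorem Calculus.Refutes.length_pos (h : S.Refutes F.pre F.matrix π) : 0 < π.length := by
  obtain ⟨s, hs⟩ := h.2.1
  refine List.length_pos_of_ne_nil ?_
  rintro rfl
  simp at hs

theorem args_selGate (F : Instance) (s : Source) : (selGate F s).args ⊆ s.premises := by
  cases s with
  | leaf k => simp [selGate, Gate.args]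
  | unary j => simp [selGate, Gate.args, Source.premises]
  | res j k x =>
    simp only [selGate]
    split_ifs <;> simp [Gate.args, Source.premises]

theorem inputs_selGate (F : Instance) (s : Source) : ∀ x ∈ (selGate F s).inputs, x ∈ F.p := by
  cases s with
  | leaf k => simp [selGate, Gate.inputs]
  | unary j => simp [selGate, Gate.inputs]
  | res j k x =>
    simp only [selGate]
    split_ifs with h <;> simp [Gate.inputs, h]

theorem Gate.args_replaceSel (g : Gate) : g.replaceSel.args = g.args := by
  cases g <;> rfl

theorem Gate.inputs_replaceSel (g : Gate) : g.replaceSel.inputs = g.inputs := by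
  cases g <;> rfl

/-- A circuit with one gate for each line that realizes the gate specification interpolates. -/
theorem IsInterpolationCircuit.of_map (hS : Interpolates S) (hF : F.WellFormed)
    (hπ : S.Refutes F.pre F.matrix π) {mono : Bool} (hmono : mono = true → F.PositiveInA)
    {gate : Source → Gate} (hargs : ∀ s, (gate s).args ⊆ s.premises)
    (hin : ∀ s, ∀ x ∈ (gate s).inputs, x ∈ F.p)
    (heval : ∀ α vs i s, vs.getD i false = (gate s).eval α vs →
      GateSpec F mono α (fun j => vs.getD j false) i s) :
    IsInterpolationCircuit F (π.map fun l => gate l.2) := by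
  have hwf : ∀ i g, (π.map fun l => gate l.2)[i]? = some g → ∀ j ∈ Gate.args g, j < i := by
    intro i g hi j hj
    rw [List.getElem?_map, Option.map_eq_some_iff] at hi
    obtain ⟨⟨C, s⟩, hl, rfl⟩ := hi
    exact hπ.premises_lt hl j (hargs s hj)
  refine ⟨⟨?_, hwf⟩, ?_, fun α => ?_⟩
  · have := hπ.length_pos
    intro h
    simp only [List.map_eq_nil_iff] at h
    simp [h] at this
  · intro g hg
    obtain ⟨l, -, rfl⟩ := List.mem_map.1 hg
    exact hin l.2
  · have key := hS F π hF hπ mono α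
      (fun j => (Circuit.values α (π.map fun l => gate l.2)).getD j false) hmono (by
        intro i C s hi
        refine heval α _ i s (Circuit.getD_values hwf α ?_)
        rw [List.getElem?_map, hi]
        rfl)
    rw [Circuit.eval_eq_getD, List.length_map]
    exact ⟨key false, key true⟩

theorem selCircuit_interpolates (hS : Interpolates S) (hF : F.WellFormed)
    (hπ : S.Refutes F.pre F.matrix π) : IsInterpolationCircuit F (selCircuit (F, π)) := by
  refine .of_map hS hF hπ (mono := false) (by simp) (args_selGate F) (inputs_selGate F) ?_
  rintro α vs i (k | j | ⟨j, k, x⟩) h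
  · exact h
  · simpa [GateSpec, selGate, Gate.eval, Gate.replaceSel] using h
  · simp only [selGate] at h
    simp only [GateSpec]
    by_cases hx : x ∈ F.p
    · rw [if_pos hx] at h ⊢
      exact h
    rw [if_neg hx] at h ⊢
    split_ifs at h ⊢ <;> exact h

theorem replaceSel_selCircuit_interpolates (hS : Interpolates S) (hF : F.WellFormed)
    (hπ : S.Refutes F.pre F.matrix π) (hpos : F.PositiveInA) :
    IsInterpolationCircuit F (selCircuit (F, π)).replaceSel := by
  rw [selCircuit, Circuit.replaceSel, List.map_map]
  refine .of_map hS hF hπ (mono := true) (fun _ => hpos) (gate := fun s => (selGate F s).replaceSel)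
    (fun s => by rw [Gate.args_replaceSel]; exact args_selGate F s)
    (fun s => by rw [Gate.inputs_replaceSel]; exact inputs_selGate F s) ?_
  rintro α vs i (k | j | ⟨j, k, x⟩) h
  · exact h
  · simpa [GateSpec, selGate, Gate.eval, Gate.replaceSel] using h
  · simp only [selGate] at h
    simp only [GateSpec]
    by_cases hx : x ∈ F.p
    · rw [if_pos hx] at h ⊢
      exact h
    rw [if_neg hx] at h ⊢
    split_ifs at h ⊢ <;> exact h

theorem selCircuit_isSelector : (selCircuit (F, π)).IsSelector := by
  intro g hg
  obtain ⟨⟨C, s⟩, -, rfl⟩ := List.mem_map.1 hg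
  cases s with
  | leaf k => trivial
  | unary j => trivial
  | res j k x =>
    simp only [selGate]
    split_ifs <;> trivial

theorem replaceSel_selCircuit_isMonotone : (selCircuit (F, π)).replaceSel.IsMonotone := by
  intro g hg
  obtain ⟨g', hg', rfl⟩ := List.mem_map.1 hg
  have := selCircuit_isSelector g' hg'
  cases g' <;> trivial

theorem inputs_stdGate (F : Instance) (pos : Bool) (b r : ℕ) (s : Source) :
    ∀ x ∈ (stdGate F pos b r s).inputs, x ∈ F.p := by
  cases s with
  | leaf k => simp [stdGate, Gate.inputs]
  | unary j => simp [stdGate, Gate.inputs]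
  | res j k x =>
    simp only [stdGate]
    split_ifs with h
    · rcases r with _ | _ | r <;> simp [orAndBlock, Gate.inputs, h]
    · rcases r with _ | _ | _ | _ | r <;> simp [selBlock, Gate.inputs, h]
    · simp [Gate.inputs]
    · simp [Gate.inputs]

theorem args_stdGate_lt (F : Instance) (pos : Bool) {i r : ℕ} {s : Source}
    (hs : ∀ j ∈ s.premises, j < i) : ∀ j ∈ (stdGate F pos (5 * i) r s).args, j < 5 * i + r := by
  cases s with
  | leaf k => simp [stdGate, Gate.args]
  | unary j =>
    simp only [Source.premises, List.mem_singleton, forall_eq] at hs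
    simp only [stdGate, Gate.args, List.mem_cons, List.not_mem_nil, or_false, or_self, forall_eq]
    omega
  | res j k x =>
    simp only [Source.premises, List.mem_cons, List.not_mem_nil, or_false, forall_eq_or_imp,
      forall_eq] at hs
    simp only [stdGate]
    split_ifs
    · rcases r with _ | _ | r <;> simp [orAndBlock, Gate.args] <;> omega
    · rcases r with _ | _ | _ | _ | r <;> simp [selBlock, Gate.args] <;> omega
    · simp [Gate.args]
      omega
    · simp [Gate.args]
      omega

theorem stdGate_isStandard (F : Instance) (pos : Bool) (b r : ℕ) (s : Source) :
    (stdGate F pos b r s).IsStandard := by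
  cases s with
  | leaf k => trivial
  | unary j => trivial
  | res j k x =>
    simp only [stdGate]
    split_ifs
    · rcases r with _ | _ | r <;> trivial
    · rcases r with _ | _ | _ | _ | r <;> trivial
    · trivial
    · trivial

theorem stdGate_isMonotone (F : Instance) (b r : ℕ) (s : Source) :
    (stdGate F true b r s).IsMonotone := by
  cases s with
  | leaf k => trivial
  | unary j => trivial
  | res j k x =>
    simp only [stdGate, if_true]
    split_ifs
    · rcases r with _ | _ | r <;> trivial
    · trivial
    · trivial

theorem stdCircuit_isStandard : (stdCircuit (F, π)).IsStandard := by
  intro g hg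
  obtain ⟨m, -, rfl⟩ := List.mem_map.1 hg
  exact stdGate_isStandard _ _ _ _ _

theorem stdCircuit_isMonotone (hF : F.PositiveInA) : (stdCircuit (F, π)).IsMonotone := by
  classical
  intro g hg
  obtain ⟨m, -, rfl⟩ := List.mem_map.1 hg
  rw [decide_eq_true (show (F, π).1.PositiveInA from hF)]
  exact stdGate_isMonotone _ _ _ _

theorem length_stdCircuit : (stdCircuit (F, π)).length = 5 * π.length := by
  simp [stdCircuit]

/-- The last gate of a block satisfies the gate specification. -/
theorem gateSpec_of_stdGate {pos : Bool} {α : ℕ → Bool} {vs : List Bool} {i : ℕ} {s : Source}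
    (h : ∀ r < 5, vs.getD (5 * i + r) false = (stdGate F pos (5 * i) r s).eval α vs) :
    GateSpec F pos α (fun j => vs.getD (5 * j + 4) false) i s := by
  have h4 := h 4 (by norm_num)
  cases s with
  | leaf k => exact h4
  | unary j =>
    have h4 : vs.getD (5 * i + 4) false =
      (vs.getD (5 * j + 4) false && vs.getD (5 * j + 4) false) := h4
    rwa [Bool.and_self] at h4
  | res j k x =>
    simp only [GateSpec]
    by_cases hx : x ∈ F.p
    · have h0 := h 0 (by norm_num)
      have h1 := h 1 (by norm_num)
      have h2 := h 2 (by norm_num)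
      have h3 := h 3 (by norm_num)
      cases pos
      · simp only [stdGate, if_pos hx, Bool.false_eq_true, if_false, selBlock, Gate.eval]
          at h0 h1 h2 h3 h4
        rw [add_zero] at h0
        rw [if_pos hx, h4, h2, h3, h1, h0]
        cases α x <;> simp
      · simp only [stdGate, if_pos hx, if_true, orAndBlock, Gate.eval] at h0 h1 h4
        rw [add_zero] at h0
        rw [if_pos hx, h4, h1, h0]
        rfl
    · simp only [stdGate, if_neg hx] at h4
      rw [if_neg hx]
      split_ifs at h4 ⊢ <;> exact h4

theorem stdCircuit_interpolates (hS : Interpolates S) (hF : F.WellFormed)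
    (hπ : S.Refutes F.pre F.matrix π) : IsInterpolationCircuit F (stdCircuit (F, π)) := by
  classical
  have hlen := length_stdCircuit (F := F) (π := π)
  have hget : ∀ i C s, π[i]? = some (C, s) → ∀ r < 5,
      (stdCircuit (F, π))[5 * i + r]? =
        some (stdGate F (decide F.PositiveInA) (5 * i) r s) := by
    intro i C s hi r hr
    have hil := (List.getElem?_eq_some_iff.1 hi).1
    have hdiv : (5 * i + r) / 5 = i := by omega
    have hmod : (5 * i + r) % 5 = r := by omega
    have hlt : 5 * i + r < 5 * π.length := by omega
    rw [stdCircuit, List.getElem?_map, List.getElem?_range hlt]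
    simp [hdiv, hmod, hi]
  have hwf : ∀ i g, (stdCircuit (F, π))[i]? = some g → ∀ j ∈ Gate.args g, j < i := by
    intro m g hm
    have hml := (List.getElem?_eq_some_iff.1 hm).1
    rw [hlen] at hml
    have hl : m / 5 < π.length := by omega
    have hi : π[m / 5]? = some (π[m / 5].1, π[m / 5].2) := List.getElem?_eq_getElem hl
    have := hget _ _ _ hi (m % 5) (Nat.mod_lt _ (by norm_num))
    rw [Nat.div_add_mod, hm, Option.some_inj] at this
    rw [this]
    intro j hj
    have := args_stdGate_lt F _ (hπ.premises_lt hi) j hj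
    rwa [Nat.div_add_mod] at this
  refine ⟨⟨?_, hwf⟩, ?_, fun α => ?_⟩
  · have := hπ.length_pos
    intro h
    rw [h, List.length_nil] at hlen
    omega
  · intro g hg
    obtain ⟨m, -, rfl⟩ := List.mem_map.1 hg
    exact inputs_stdGate _ _ _ _ _
  · have key := hS F π hF hπ (decide F.PositiveInA) α
      (fun i => (Circuit.values α (stdCircuit (F, π))).getD (5 * i + 4) false)
      (fun h => of_decide_eq_true h) fun i C s hi => gateSpec_of_stdGate fun r hr =>
        Circuit.getD_values hwf α (hget i C s hi r hr)
    have h5 : 5 * π.length - 1 = 5 * (π.length - 1) + 4 := by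
      have := hπ.length_pos
      omega
    rw [Circuit.eval_eq_getD, hlen, h5]
    exact ⟨key false, key true⟩

end

/-! ### The circuits are computed effectively -/

section

variable {α β : Type*} [Primcodable α] [Primcodable β]

theorem primrec_instance : Primrec instanceEquiv := Primrec.of_equiv

theorem primrec_p : Primrec Instance.p := Primrec.fst.comp primrec_instance

theorem primrec_q : Primrec Instance.q := Primrec.fst.comp (Primrec.snd.comp primrec_instance)

theorem primrec_A : Primrec Instance.A :=
  Primrec.fst.comp (Primrec.snd.comp (Primrec.snd.comp (Primrec.snd.comp primrec_instance)))

/-- Case distinction on the origin of a line, transported to a sum type along `sourceEquiv`. The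
function is specified by its values in the three cases, so that definitions by pattern matching fit
directly. -/
theorem primrec_source_elim {s : α → Source} {f g : α → ℕ → β} {h : α → ℕ × ℕ × ℕ → β}
    (hs : Primrec s) (hf : Primrec₂ f) (hg : Primrec₂ g) (hh : Primrec₂ h) {e : α → β}
    (leaf : ∀ a k, s a = Source.leaf k → e a = f a k)
    (unary : ∀ a j, s a = Source.unary j → e a = g a j)
    (res : ∀ a j k x, s a = Source.res j k x → e a = h a (j, k, x)) : Primrec e := by
  have h1 : Primrec₂ fun (a : α) (t : ℕ ⊕ ℕ × ℕ × ℕ) =>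
      (Sum.casesOn t (g a) (h a) : β) :=
    Primrec.sumCasesOn Primrec.snd
      (hg.comp (Primrec.fst.comp Primrec.fst) Primrec.snd).to₂
      (hh.comp (Primrec.fst.comp Primrec.fst) Primrec.snd).to₂
  refine (Primrec.sumCasesOn ((Primrec.of_equiv (e := sourceEquiv)).comp hs) hf h1).of_eq
    fun a => ?_
  cases hsa : s a with
  | leaf k => exact (leaf a k hsa).symm
  | unary j => exact (unary a j hsa).symm
  | res j k x => exact (res a j k x hsa).symm

theorem primrec_gate {f : α → Bool ⊕ ℕ ⊕ ℕ ⊕ (ℕ × ℕ) ⊕ (ℕ × ℕ) ⊕ (ℕ × ℕ × ℕ) ⊕ (ℕ × ℕ × ℕ)}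
    (hf : Primrec f) : Primrec fun a => gateEquiv.symm (f a) :=
  (Primrec.of_equiv_symm (e := gateEquiv)).comp hf

section Gates

variable {f g h : α → ℕ}

theorem primrec_const {b : α → Bool} (hb : Primrec b) : Primrec fun a => Gate.const (b a) :=
  primrec_gate (Primrec.sumInl.comp hb)

theorem primrec_input (hf : Primrec f) : Primrec fun a => Gate.input (f a) :=
  primrec_gate (Primrec.sumInr.comp (Primrec.sumInl.comp hf))

theorem primrec_not (hf : Primrec f) : Primrec fun a => Gate.not (f a) :=
  primrec_gate (Primrec.sumInr.comp (Primrec.sumInr.comp (Primrec.sumInl.comp hf)))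

theorem primrec_and (hf : Primrec f) (hg : Primrec g) : Primrec fun a => Gate.and (f a) (g a) :=
  primrec_gate (Primrec.sumInr.comp (Primrec.sumInr.comp (Primrec.sumInr.comp
    (Primrec.sumInl.comp (hf.pair hg)))))

theorem primrec_or (hf : Primrec f) (hg : Primrec g) : Primrec fun a => Gate.or (f a) (g a) :=
  primrec_gate (Primrec.sumInr.comp (Primrec.sumInr.comp (Primrec.sumInr.comp
    (Primrec.sumInr.comp (Primrec.sumInl.comp (hf.pair hg))))))

theorem primrec_sel (hf : Primrec f) (hg : Primrec g) (hh : Primrec h) :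
    Primrec fun a => Gate.sel (f a) (g a) (h a) :=
  primrec_gate (Primrec.sumInr.comp (Primrec.sumInr.comp (Primrec.sumInr.comp
    (Primrec.sumInr.comp (Primrec.sumInr.comp (Primrec.sumInl.comp (hf.pair (hg.pair hh))))))))

end Gates

theorem primrecPred_mem {x : α → β} {l : α → List β} (hx : Primrec x) (hl : Primrec l) :
    PrimrecPred fun a => x a ∈ l a := by
  have h : PrimrecRel fun (l : List β) (x : β) => ∃ y ∈ l, y = x :=
    PrimrecRel.exists_mem_list Primrec.eq
  exact (PrimrecRel.comp h hl hx).of_eq fun a => by simp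

/-- The procedure for the usual basis has to decide this condition to choose between the monotone
and the selector block; only quantifiers bounded by the lists `A` and `p` are involved. -/
theorem primrecPred_positiveInA : PrimrecPred Instance.PositiveInA := by
  have h1 : PrimrecRel fun (x : ℕ) (C : List Lit) => (x, false) ∉ C :=
    (primrecPred_mem (x := fun t : ℕ × List Lit => (t.1, false)) (l := Prod.snd)
      (Primrec.fst.pair (Primrec.const false)) Primrec.snd).not
  have h2 : PrimrecRel fun (C : List Lit) (p : List ℕ) => ∀ x ∈ p, (x, false) ∉ C :=
    (PrimrecRel.forall_mem_list h1).swap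
  exact (PrimrecRel.forall_mem_list h2).comp primrec_A primrec_p

end

section

variable {Λ : Type} [Primcodable Λ]

theorem primrec_qVars : Primrec fun F : Instance => F.q.map Prod.snd :=
  Primrec.list_map primrec_q (Primrec.snd.comp Primrec.snd).to₂

theorem primrec_selGate : Primrec₂ selGate := by
  have F {γ : Type} [Primcodable γ] : Primrec fun t : (Instance × Source) × γ => t.1.1 :=
    Primrec.fst.comp Primrec.fst
  have j : Primrec fun t : (Instance × Source) × ℕ × ℕ × ℕ => t.2.1 :=
    Primrec.fst.comp Primrec.snd
  have k : Primrec fun t : (Instance × Source) × ℕ × ℕ × ℕ => t.2.2.1 :=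
    Primrec.fst.comp (Primrec.snd.comp Primrec.snd)
  have x : Primrec fun t : (Instance × Source) × ℕ × ℕ × ℕ => t.2.2.2 :=
    Primrec.snd.comp (Primrec.snd.comp Primrec.snd)
  refine primrec_source_elim (s := fun t : Instance × Source => t.2)
    (f := fun t k => Gate.const (decide (t.1.A.length ≤ k))) (g := fun _ j => Gate.and j j)
    (h := fun t s => if s.2.2 ∈ t.1.p then Gate.sel s.2.2 s.1 s.2.1
      else if s.2.2 ∈ t.1.q.map Prod.snd then Gate.or s.1 s.2.1 else Gate.and s.1 s.2.1)
    Primrec.snd ?_ ?_ ?_ ?_ ?_ ?_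
  · exact primrec_const (PrimrecPred.decide (Primrec.nat_le.comp
      (Primrec.list_length.comp (primrec_A.comp F)) Primrec.snd))
  · exact primrec_and Primrec.snd Primrec.snd
  · exact Primrec.ite (primrecPred_mem x (primrec_p.comp F)) (primrec_sel x j k)
      (Primrec.ite (primrecPred_mem x (primrec_qVars.comp F)) (primrec_or j k) (primrec_and j k))
  · rintro ⟨F, s⟩ k (rfl : s = _)
    rfl
  · rintro ⟨F, s⟩ k (rfl : s = _)
    rfl
  · rintro ⟨F, s⟩ j k x (rfl : s = _)
    rfl

theorem primrec_selCircuit : Primrec (selCircuit (Λ := Λ)) :=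
  Primrec.list_map Primrec.snd (primrec_selGate.comp (Primrec.fst.comp Primrec.fst)
    (Primrec.snd.comp Primrec.snd)).to₂

section Blocks

variable {α : Type*} [Primcodable α] {x b g h r : α → ℕ}

theorem primrec_offset (hb : Primrec b) (n : ℕ) : Primrec fun a => b a + n :=
  Primrec.nat_add.comp hb (Primrec.const n)

theorem primrecPred_eq_const (hr : Primrec r) (n : ℕ) : PrimrecPred fun a => r a = n :=
  Primrec.eq.comp hr (Primrec.const n)

theorem primrec_selBlock (hx : Primrec x) (hb : Primrec b) (hg : Primrec g) (hh : Primrec h)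
    (hr : Primrec r) : Primrec fun a => selBlock (x a) (b a) (g a) (h a) (r a) := by
  refine (Primrec.ite (primrecPred_eq_const hr 0) (primrec_input hx) <|
    Primrec.ite (primrecPred_eq_const hr 1) (primrec_not hb) <|
    Primrec.ite (primrecPred_eq_const hr 2) (primrec_and (primrec_offset hb 1) hg) <|
    Primrec.ite (primrecPred_eq_const hr 3) (primrec_and hb hh)
      (primrec_or (primrec_offset hb 2) (primrec_offset hb 3))).of_eq fun a => ?_
  rcases r a with _ | _ | _ | _ | n <;> rfl

theorem primrec_orAndBlock (hx : Primrec x) (hb : Primrec b) (hg : Primrec g) (hh : Primrec h)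
    (hr : Primrec r) : Primrec fun a => orAndBlock (x a) (b a) (g a) (h a) (r a) := by
  refine (Primrec.ite (primrecPred_eq_const hr 0) (primrec_input hx) <|
    Primrec.ite (primrecPred_eq_const hr 1) (primrec_or hb hg)
      (primrec_and (primrec_offset hb 1) hh)).of_eq fun a => ?_
  rcases r a with _ | _ | n <;> rfl

theorem primrec_last (hb : Primrec b) : Primrec fun a => 5 * b a + 4 :=
  primrec_offset (Primrec.nat_mul.comp (Primrec.const 5) hb) 4

end Blocks

theorem primrec_stdGate {α : Type*} [Primcodable α] {F : α → Instance} {pos : α → Bool}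
    {b r : α → ℕ} {s : α → Source} (hF : Primrec F) (hpos : Primrec pos) (hb : Primrec b)
    (hr : Primrec r) (hs : Primrec s) :
    Primrec fun a => stdGate (F a) (pos a) (b a) (r a) (s a) := by
  have j : Primrec fun t : α × ℕ × ℕ × ℕ => 5 * t.2.1 + 4 :=
    primrec_last (Primrec.fst.comp Primrec.snd)
  have k : Primrec fun t : α × ℕ × ℕ × ℕ => 5 * t.2.2.1 + 4 :=
    primrec_last (Primrec.fst.comp (Primrec.snd.comp Primrec.snd))
  have x : Primrec fun t : α × ℕ × ℕ × ℕ => t.2.2.2 :=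
    Primrec.snd.comp (Primrec.snd.comp Primrec.snd)
  have hF' {γ : Type} [Primcodable γ] : Primrec fun t : α × γ => F t.1 := hF.comp Primrec.fst
  have hb' : Primrec fun t : α × ℕ × ℕ × ℕ => b t.1 := hb.comp Primrec.fst
  have hr' : Primrec fun t : α × ℕ × ℕ × ℕ => r t.1 := hr.comp Primrec.fst
  refine primrec_source_elim
    (f := fun a k => Gate.const (decide ((F a).A.length ≤ k)))
    (g := fun _ j => Gate.and (5 * j + 4) (5 * j + 4))
    (h := fun a t => if t.2.2 ∈ (F a).p then
        if pos a = true then orAndBlock t.2.2 (b a) (5 * t.1 + 4) (5 * t.2.1 + 4) (r a)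
        else selBlock t.2.2 (b a) (5 * t.1 + 4) (5 * t.2.1 + 4) (r a)
      else if t.2.2 ∈ (F a).q.map Prod.snd then Gate.or (5 * t.1 + 4) (5 * t.2.1 + 4)
      else Gate.and (5 * t.1 + 4) (5 * t.2.1 + 4))
    hs ?_ ?_ ?_ ?_ ?_ ?_
  · exact primrec_const (PrimrecPred.decide (Primrec.nat_le.comp
      (Primrec.list_length.comp (primrec_A.comp hF')) Primrec.snd))
  · exact primrec_and (primrec_last Primrec.snd) (primrec_last Primrec.snd)
  · exact Primrec.ite (primrecPred_mem x (primrec_p.comp hF'))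
      (Primrec.ite (Primrec.eq.comp (hpos.comp Primrec.fst) (Primrec.const true))
        (primrec_orAndBlock x hb' j k hr') (primrec_selBlock x hb' j k hr'))
      (Primrec.ite (primrecPred_mem x (primrec_qVars.comp hF')) (primrec_or j k)
        (primrec_and j k))
  all_goals
    intros
    simp only [*, stdGate]

theorem primrec_stdCircuit : Primrec (stdCircuit (Λ := Λ)) := by
  classical
  have div : Primrec fun t : (Instance × ProofGraph Λ) × ℕ => t.2 / 5 :=
    Primrec.nat_div.comp Primrec.snd (Primrec.const 5)
  have line : Primrec fun t : (Instance × ProofGraph Λ) × ℕ =>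
      (t.1.2[t.2 / 5]?.map Prod.snd).getD (Source.leaf 0) :=
    Primrec.option_getD.comp (Primrec.option_map
      (Primrec.list_getElem?.comp (Primrec.snd.comp Primrec.fst) div)
      (Primrec.snd.comp Primrec.snd).to₂) (Primrec.const _)
  have gate : Primrec fun t : (Instance × ProofGraph Λ) × ℕ =>
      stdGate t.1.1 (decide t.1.1.PositiveInA) (5 * (t.2 / 5)) (t.2 % 5)
        ((t.1.2[t.2 / 5]?.map Prod.snd).getD (Source.leaf 0)) :=
    primrec_stdGate (Primrec.fst.comp Primrec.fst)
      (primrecPred_positiveInA.decide.comp (Primrec.fst.comp Primrec.fst))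
      (Primrec.nat_mul.comp (Primrec.const 5) div)
      (Primrec.nat_mod.comp Primrec.snd (Primrec.const 5)) line
  exact Primrec.list_map (Primrec.list_range.comp (Primrec.nat_mul.comp (Primrec.const 5)
    (Primrec.list_length.comp Primrec.snd))) gate.to₂

theorem Interpolates.hasMonotoneFeasibleInterpolation {S : Calculus Λ} (hS : Interpolates S) :
    HasMonotoneFeasibleInterpolation S := by
  refine ⟨stdCircuit, primrec_stdCircuit.to_comp, 5 * Polynomial.X, fun F π hF hπ =>
    ⟨stdCircuit_interpolates hS hF hπ, stdCircuit_isStandard, ?_, stdCircuit_isMonotone⟩⟩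
  simp [length_stdCircuit]

theorem Interpolates.monotoneBySelectorReplacement {S : Calculus Λ} (hS : Interpolates S) :
    MonotoneBySelectorReplacement S := by
  refine ⟨selCircuit, primrec_selCircuit.to_comp, Polynomial.X, fun F π hF hπ =>
    ⟨selCircuit_interpolates hS hF hπ, selCircuit_isSelector, ?_, fun hpos =>
      ⟨replaceSel_selCircuit_interpolates hS hF hπ hpos, replaceSel_selCircuit_isMonotone⟩⟩⟩
  simp [selCircuit]

theorem Interpolates.both {S : Calculus Λ} (hS : Interpolates S) :
    HasMonotoneFeasibleInterpolation S ∧ MonotoneBySelectorReplacement S :=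
  ⟨hS.hasMonotoneFeasibleInterpolation, hS.monotoneBySelectorReplacement⟩

end

end QBFInterpolation

/-- Monotone feasible interpolation, and its realization by replacing selector gates, first for
LQU⁺-Res and IRM-calc, then for the other QBF resolution systems. -/
theorem theorem3p5 :
    (QBFInterpolation.HasMonotoneFeasibleInterpolation QBFInterpolation.lquPlusRes ∧
      QBFInterpolation.MonotoneBySelectorReplacement QBFInterpolation.lquPlusRes) ∧
    (QBFInterpolation.HasMonotoneFeasibleInterpolation QBFInterpolation.irmCalc ∧
      QBFInterpolation.MonotoneBySelectorReplacement QBFInterpolation.irmCalc) ∧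
    (∀ S ∈ ({QBFInterpolation.treeQRes, QBFInterpolation.qRes, QBFInterpolation.ldQRes,
        QBFInterpolation.quRes} : Set (QBFInterpolation.Calculus QBFInterpolation.MLit)),
      QBFInterpolation.HasMonotoneFeasibleInterpolation S ∧
        QBFInterpolation.MonotoneBySelectorReplacement S) ∧
    (∀ S ∈ ({QBFInterpolation.forallExpRes, QBFInterpolation.irCalc} :
        Set (QBFInterpolation.Calculus QBFInterpolation.ALit)),
      QBFInterpolation.HasMonotoneFeasibleInterpolation S ∧
        QBFInterpolation.MonotoneBySelectorReplacement S) := by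
  refine ⟨QBFInterpolation.interpolates_lquPlusRes.both,
    QBFInterpolation.interpolates_irmCalc.both, ?_, ?_⟩
  · rintro S (rfl | rfl | rfl | rfl)
    · exact QBFInterpolation.interpolates_treeQRes.both
    · exact QBFInterpolation.interpolates_qRes.both
    · exact QBFInterpolation.interpolates_ldQRes.both
    · exact QBFInterpolation.interpolates_quRes.both
  · rintro S (rfl | rfl)
    · exact QBFInterpolation.interpolates_forallExpRes.both
    · exact QBFInterpolation.interpolates_irCalc.both
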